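/- Let $\mathbb D$ be the open unit disk in $\mathbb C$ and $H(\mathbb D)$ the set of analytic functions on $\mathbb D$. Let $H^\infty$ be the Banach space of bounded $f\in H(\mathbb D)$ with the supremum norm, and let the Bloch space $\mathcal B$ be the set of $f\in H(\mathbb D)$ with $\|f\|_{\mathcal B}:=\sup_{z\in\mathbb D}(1-|z|^2)|f'(z)|<\infty$, a Banach space under the norm $|f(0)|+\|f\|_{\mathcal B}$. For $a\in\mathbb D$ put $\sigma_a(z)=\frac{a-z}{1-\bar a z}$. Let $u,v\in H(\mathbb D)$ and let $\varphi,\psi$ be analytic self-maps of $\mathbb D$. Write $\rho(z)=\left|\frac{\varphi(z)-\psi(z)}{1-\overline{\psi(z)}\varphi(z)}\right|$ and $(uC_\varphi f)(z)=u(z)f(\varphi(z))$, $(vC_\psi f)(z)=v(z)f(\psi(z))$. Assume (A) $\sup_{z\in\mathbb D}(1-|z|^2)|u'(z)|\rho(z)<\infty$ and $\sup_{z\in\mathbb D}(1-|z|^2)|v'(z)|\rho(z)<\infty$; (B) $(1-|z|^2)|u'(z)|\rho(z)\to0$ and $(1-|z|^2)|v'(z)|\rho(z)\to0$ as $\rho(z)\to0$;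 that is, for every $\varepsilon>0$ there is $\delta>0$ such that both quantities are less than $\varepsilon$ at every $z\in\mathbb D$ with $\rho(z)<\delta$. Suppose that $uC_\varphi-vC_\psi$ is a bounded operator from $H^\infty$ to $\mathcal B$. Then the following are equivalent: (i) $uC_\varphi-vC_\psi:H^\infty\to\mathcal B$ is compact; (ii) for every $(n,m)\in\{(0,0),(0,1),(0,2),(1,2)\}$, $$\lim_{|a|\to1}\ \sup_{b\in\mathbb D}\left\|(uC_\varphi-vC_\psi)\big((\sigma_a^{n+1}-a\sigma_a^{n})\sigma_b^{m}\big)\right\|_{\mathcal B}=0;$$ (iii) $\displaystyle\lim_{k\to\infty}\|u\varphi^k-v\psi^k\|_{\mathcal B}=0.$ -/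

import Mathlib

open Filter Topology
open scoped ENNReal ComplexConjugate BoundedContinuousFunction Complex.UnitDisc

noncomputable section

namespace BlochDiff

/-- The extension by zero to `ℂ` of a function on the open unit disc. Inside the disc it has the
same values and the same derivatives as the given function. -/
def ext (f : 𝔻 → ℂ) : ℂ → ℂ := Function.extend Complex.UnitDisc.coe f 0

/-- `f` is analytic in the open unit disc, i.e. `f ∈ H(𝔻)`. -/
def Holo (f : 𝔻 → ℂ) : Prop := DifferentiableOn ℂ (ext f) (Metric.ball 0 1)

/-- The complex derivative `f'(z)` of a function on the disc. -/
def dderiv (f : 𝔻 → ℂ) (z : 𝔻) : ℂ := deriv (ext f) (z : ℂ)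

theorem ext_coe (f : 𝔻 → ℂ) (z : 𝔻) : ext f (z : ℂ) = f z :=
  Complex.UnitDisc.coe_injective.extend_apply f 0 z

theorem ext_outside (f : 𝔻 → ℂ) {w : ℂ} (hw : ¬ ‖w‖ < 1) : ext f w = 0 := by
  unfold ext
  rw [Function.extend_apply']
  · rfl
  · rintro ⟨z, rfl⟩
    exact hw z.norm_lt_one

theorem ext_add (f g : 𝔻 → ℂ) : ext (f + g) = ext f + ext g := by
  funext w
  by_cases hw : ‖w‖ < 1
  · lift w to 𝔻 using hw
    simp [ext_coe]
  · simp [ext_outside _ hw]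

theorem ext_smul (c : ℂ) (f : 𝔻 → ℂ) : ext (c • f) = c • ext f := by
  funext w
  by_cases hw : ‖w‖ < 1
  · lift w to 𝔻 using hw
    simp [ext_coe]
  · simp [ext_outside _ hw]

theorem ext_zero : ext 0 = 0 := by
  simpa using ext_smul 0 0

theorem Holo.differentiableAt {f : 𝔻 → ℂ} (hf : Holo f) (z : 𝔻) :
    DifferentiableAt ℂ (ext f) (z : ℂ) :=
  DifferentiableOn.differentiableAt hf
    (Metric.isOpen_ball.mem_nhds (mem_ball_zero_iff.2 z.norm_lt_one))

theorem Holo.add {f g : 𝔻 → ℂ} (hf : Holo f) (hg : Holo g) : Holo (f + g) := by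
  unfold Holo
  rw [ext_add]
  exact DifferentiableOn.add hf hg

theorem Holo.smul (c : ℂ) {f : 𝔻 → ℂ} (hf : Holo f) : Holo (c • f) := by
  unfold Holo
  rw [ext_smul]
  exact DifferentiableOn.const_smul hf c

theorem Holo.zero : Holo 0 := by
  unfold Holo
  rw [ext_zero]
  exact differentiableOn_const 0

theorem dderiv_add {f g : 𝔻 → ℂ} (hf : Holo f) (hg : Holo g) (z : 𝔻) :
    dderiv (f + g) z = dderiv f z + dderiv g z := by
  unfold dderiv
  rw [ext_add]
  exact deriv_add (hf.differentiableAt z) (hg.differentiableAt z)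

theorem dderiv_smul (c : ℂ) {f : 𝔻 → ℂ} (hf : Holo f) (z : 𝔻) :
    dderiv (c • f) z = c * dderiv f z := by
  unfold dderiv
  rw [ext_smul]
  exact deriv_const_smul c (hf.differentiableAt z)

/-- The space `H^∞` of bounded analytic functions on the disc. Its norm, inherited from the
bounded continuous functions, is the supremum norm. -/
def HInf : Submodule ℂ (𝔻 →ᵇ ℂ) where
  carrier := {f | Holo f}
  add_mem' hf hg := Holo.add hf hg
  zero_mem' := Holo.zero
  smul_mem' c _ hf := Holo.smul c hf

/-- The Bloch seminorm `‖f‖_𝓑 = sup_z (1 - |z|²) |f'(z)|`, with value in `[0, ∞]`. -/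
def blochSemi (f : 𝔻 → ℂ) : ℝ≥0∞ :=
  ⨆ z : 𝔻, ENNReal.ofReal ((1 - ‖(z : ℂ)‖ ^ 2) * ‖dderiv f z‖)

theorem blochSemi_add_le {f g : 𝔻 → ℂ} (hf : Holo f) (hg : Holo g) :
    blochSemi (f + g) ≤ blochSemi f + blochSemi g := by
  refine iSup_le fun z => ?_
  have hz : 0 ≤ 1 - ‖(z : ℂ)‖ ^ 2 := (sub_pos.2 z.sq_norm_lt_one).le
  refine le_trans ?_ (add_le_add (le_iSup _ z) (le_iSup _ z))
  rw [← ENNReal.ofReal_add (by positivity) (by positivity), dderiv_add hf hg, ← mul_add]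
  exact ENNReal.ofReal_le_ofReal (mul_le_mul_of_nonneg_left (norm_add_le _ _) hz)

theorem blochSemi_smul (c : ℂ) {f : 𝔻 → ℂ} (hf : Holo f) :
    blochSemi (c • f) = ENNReal.ofReal ‖c‖ * blochSemi f := by
  unfold blochSemi
  rw [ENNReal.mul_iSup]
  refine iSup_congr fun z => ?_
  rw [dderiv_smul c hf, norm_mul, ← ENNReal.ofReal_mul (norm_nonneg _)]
  congr 1
  ring

theorem blochSemi_zero : blochSemi 0 = 0 := by
  simpa using blochSemi_smul 0 Holo.zero

/-- The underlying vector space of the Bloch space. -/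
def blochSubmodule : Submodule ℂ (𝔻 → ℂ) where
  carrier := {f | Holo f ∧ blochSemi f < ∞}
  add_mem' hf hg := ⟨hf.1.add hg.1,
    (blochSemi_add_le hf.1 hg.1).trans_lt (ENNReal.add_lt_top.2 ⟨hf.2, hg.2⟩)⟩
  zero_mem' := ⟨Holo.zero, by rw [blochSemi_zero]; exact ENNReal.zero_lt_top⟩
  smul_mem' c f hf := ⟨hf.1.smul c, by
    rw [blochSemi_smul c hf.1]
    exact ENNReal.mul_lt_top ENNReal.ofReal_lt_top hf.2⟩

/-- The Bloch space `𝓑`. It is a separate type, so that its topology is the one of the Bloch norm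
and not the one of pointwise convergence. -/
def Bloch : Type := ↥blochSubmodule

namespace Bloch

instance : AddCommGroup Bloch := inferInstanceAs (AddCommGroup ↥blochSubmodule)

instance : Module ℂ Bloch := inferInstanceAs (Module ℂ ↥blochSubmodule)

/-- The function on the disc underlying an element of the Bloch space. -/
def toFun (f : Bloch) : 𝔻 → ℂ := Subtype.val f

theorem holo (f : Bloch) : Holo f.toFun := (Subtype.property f).1

theorem semi_lt_top (f : Bloch) : blochSemi f.toFun < ∞ := (Subtype.property f).2

/-- The Bloch norm `|f(0)| + ‖f‖_𝓑`. -/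
instance : Norm Bloch := ⟨fun f => ‖f.toFun 0‖ + (blochSemi f.toFun).toReal⟩

theorem norm_def (f : Bloch) : ‖f‖ = ‖f.toFun 0‖ + (blochSemi f.toFun).toReal := rfl

theorem toFun_add (f g : Bloch) : (f + g).toFun = f.toFun + g.toFun := rfl

theorem toFun_smul (c : ℂ) (f : Bloch) : (c • f).toFun = c • f.toFun := rfl

theorem eq_zero_of_norm (f : Bloch) (h : ‖f‖ = 0) : f = 0 := by
  rw [norm_def] at h
  obtain ⟨h0, h1⟩ := (add_eq_zero_iff_of_nonneg (norm_nonneg _) ENNReal.toReal_nonneg).1 h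
  have h2 : blochSemi f.toFun = 0 :=
    ((ENNReal.toReal_eq_zero_iff _).1 h1).resolve_right f.semi_lt_top.ne
  have hd : ∀ w ∈ Metric.ball (0 : ℂ) 1, deriv (ext f.toFun) w = 0 := by
    intro w hw
    rw [mem_ball_zero_iff] at hw
    lift w to 𝔻 using hw
    have h3 := ENNReal.iSup_eq_zero.1 h2 w
    rw [ENNReal.ofReal_eq_zero] at h3
    have h4 : 0 < 1 - ‖(w : ℂ)‖ ^ 2 := sub_pos.2 w.sq_norm_lt_one
    have h5 : ‖dderiv f.toFun w‖ ≤ 0 := by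
      by_contra! h6
      exact absurd (mul_pos h4 h6) (not_lt.2 h3)
    exact norm_le_zero_iff.1 h5
  apply Subtype.ext
  funext z
  have h7 := Metric.isOpen_ball.is_const_of_deriv_eq_zero
    (convex_ball (0 : ℂ) 1).isPreconnected f.holo hd
    (mem_ball_zero_iff.2 z.norm_lt_one) (Metric.mem_ball_self one_pos)
  have h8 : ext f.toFun 0 = f.toFun 0 := ext_coe f.toFun 0
  rw [ext_coe, h8, norm_eq_zero.1 h0] at h7
  exact h7

theorem core : NormedSpace.Core ℂ Bloch where
  norm_nonneg f := add_nonneg (norm_nonneg _) ENNReal.toReal_nonneg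
  norm_smul c f := by
    rw [norm_def, norm_def, toFun_smul, blochSemi_smul c f.holo, ENNReal.toReal_mul,
      ENNReal.toReal_ofReal (norm_nonneg c), Pi.smul_apply, norm_smul, mul_add]
  norm_triangle f g := by
    rw [norm_def, norm_def, norm_def, toFun_add, Pi.add_apply]
    have h1 := norm_add_le (f.toFun 0) (g.toFun 0)
    have h2 := ENNReal.toReal_mono
      (ENNReal.add_lt_top.2 ⟨f.semi_lt_top, g.semi_lt_top⟩).ne (blochSemi_add_le f.holo g.holo)
    rw [ENNReal.toReal_add f.semi_lt_top.ne g.semi_lt_top.ne] at h2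
    linarith
  norm_eq_zero_iff f := by
    refine ⟨eq_zero_of_norm f, ?_⟩
    rintro rfl
    have h : (0 : Bloch).toFun = 0 := rfl
    rw [norm_def, h, blochSemi_zero]
    simp

instance : NormedAddCommGroup Bloch := NormedAddCommGroup.ofCore core

instance : NormedSpace ℂ Bloch := NormedSpace.ofCore core

end Bloch

/-- The weighted composition operator `(u C_φ f)(z) = u(z) f(φ(z))`. -/
def wComp (u : 𝔻 → ℂ) (φ : 𝔻 → 𝔻) : (𝔻 → ℂ) →ₗ[ℂ] (𝔻 → ℂ) where
  toFun f := fun z => u z * f (φ z)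
  map_add' f g := by
    funext z
    simp [mul_add]
  map_smul' c f := by
    funext z
    simp [mul_left_comm]

/-- `S` restricts to the continuous linear operator `T : H^∞ → 𝓑`. -/
def Restricts (S : (𝔻 → ℂ) →ₗ[ℂ] (𝔻 → ℂ)) (T : HInf →L[ℂ] Bloch) : Prop :=
  ∀ f : HInf, (T f).toFun = S (f : 𝔻 →ᵇ ℂ)

/-- `S : H^∞ → 𝓑` is bounded. -/
def IsBoundedOp (S : (𝔻 → ℂ) →ₗ[ℂ] (𝔻 → ℂ)) : Prop :=
  ∃ T : HInf →L[ℂ] Bloch, Restricts S T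

/-- `S : H^∞ → 𝓑` is compact. -/
def IsCompactOp (S : (𝔻 → ℂ) →ₗ[ℂ] (𝔻 → ℂ)) : Prop :=
  ∃ T : HInf →L[ℂ] Bloch, Restricts S T ∧ IsCompactOperator T

/-- The disc automorphism `σ_a(z) = (a - z) / (1 - ā z)`, as a complex-valued function. -/
def σ (a : 𝔻) : 𝔻 → ℂ := fun z => ((a : ℂ) - z) / (1 - conj (a : ℂ) * z)

/-- The pseudo-hyperbolic distance `ρ(z, w) = |σ_w(z)|`. -/
def pseudoDist (z w : 𝔻) : ℝ := ‖σ w z‖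

/-- `(1 - |z|²) |u'(z)| ρ(φ(z), ψ(z))`. -/
def weight (φ ψ : 𝔻 → 𝔻) (u : 𝔻 → ℂ) (z : 𝔻) : ℝ :=
  (1 - ‖(z : ℂ)‖ ^ 2) * ‖dderiv u z‖ * pseudoDist (φ z) (ψ z)

/-- `(1 - |z|²) |u'(z)| ρ(φ(z), ψ(z))` and its analogue for `v` are bounded on the disc. -/
def CondA (u v : 𝔻 → ℂ) (φ ψ : 𝔻 → 𝔻) : Prop :=
  BddAbove (Set.range (weight φ ψ u)) ∧ BddAbove (Set.range (weight φ ψ v))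

/-- The filter on the disc that describes `ρ(φ(z), ψ(z)) → 0`. -/
def rhoToZero (φ ψ : 𝔻 → 𝔻) : Filter 𝔻 :=
  comap (fun z => pseudoDist (φ z) (ψ z)) (𝓝 0)

/-- `(1 - |z|²) |u'(z)| ρ(φ(z), ψ(z))` and its analogue for `v` tend to `0` as
`ρ(φ(z), ψ(z)) → 0`. -/
def CondB (u v : 𝔻 → ℂ) (φ ψ : 𝔻 → 𝔻) : Prop :=
  Tendsto (weight φ ψ u) (rhoToZero φ ψ) (𝓝 0) ∧ Tendsto (weight φ ψ v) (rhoToZero φ ψ) (𝓝 0)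

/-- The filter on the disc that describes `|a| → 1`. -/
def toBoundary : Filter 𝔻 := comap (fun a : 𝔻 => ‖(a : ℂ)‖) (𝓝 1)

/-- The test function `(σ_a^{n+1} - a σ_a^n) σ_b^m`. -/
def testFun (n m : ℕ) (a b : 𝔻) : 𝔻 → ℂ :=
  (σ a ^ (n + 1) - (a : ℂ) • σ a ^ n) * σ b ^ m

end BlochDiff

end

open BlochDiff

/-!
At a point `z`, the functional `f ↦ (1 - |z|²) (u · f ∘ φ - v · f ∘ ψ)'(z)` is the difference of two
functionals depending only on the values and the invariant derivatives of `f` at `φ z` and `ψ z`.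
The operator is compact if and only if these functionals tend to zero uniformly in `z` along
bounded families in `H^∞` which tend to zero locally uniformly.

The test functions with `a = φ z` and `b = φ z` or `b = ψ z` have simple values and derivatives at
these two points, so condition (ii) controls the coefficients of the functionals: where `φ z` and
`ψ z` stay apart and approach the circle, the coefficients tend to zero, and where they come
together, the two functionals cancel by the Schwarz lemma.

Powers of `z` lead to the test functions through `(1 - ā z) (σ_a - a) = -(1 - |a|²) z`. For a
bounded operator `T`, it expresses `T(z^k (σ_a - a) g)` by `ā T(z^{k+1} (σ_a - a) g)` and a
multiple of `(1 - |a|²) T(z^{k+1} g)`. Since `(1 - |a|²) / (1 - |a|) ≤ 2`, smallness of `T(z^k g)`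
for large `k` passes to `T(z^k (σ_a - a) g)`, uniformly in `a`, and descending to `k = 0` costs
only a multiple of `1 - |a|²`.
-/

noncomputable section

namespace BlochDiff

/-! ### Functions on the disc -/

section Functions

variable {f g u : 𝔻 → ℂ} {φ : 𝔻 → 𝔻}

theorem hasDerivAt_ext {G : ℂ → ℂ} (h : ∀ w : 𝔻, f w = G w) {z : 𝔻} {G' : ℂ}
    (hG : HasDerivAt G G' z) : HasDerivAt (ext f) G' z := by
  refine hG.congr_of_eventuallyEq ?_
  filter_upwards [Metric.isOpen_ball.mem_nhds (mem_ball_zero_iff.2 z.norm_lt_one)] with w hw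
  lift w to 𝔻 using mem_ball_zero_iff.1 hw
  rw [ext_coe, h]

theorem holo_of_hasDerivAt {f' : 𝔻 → ℂ} (h : ∀ z : 𝔻, HasDerivAt (ext f) (f' z) z) :
    Holo f := by
  intro w hw
  lift w to 𝔻 using mem_ball_zero_iff.1 hw
  exact (h w).differentiableAt.differentiableWithinAt

theorem Holo.hasDerivAt (hf : Holo f) (z : 𝔻) : HasDerivAt (ext f) (dderiv f z) z :=
  (hf.differentiableAt z).hasDerivAt

theorem Holo.continuous (hf : Holo f) : Continuous f :=
  (ContinuousOn.comp_continuous (DifferentiableOn.continuousOn hf)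
    Complex.UnitDisc.continuous_coe fun z => mem_ball_zero_iff.2 z.norm_lt_one).congr (ext_coe f)

theorem hasDerivAt_ext_mul (hf : Holo f) (hg : Holo g) (z : 𝔻) :
    HasDerivAt (ext (f * g)) (dderiv f z * g z + f z * dderiv g z) z := by
  simpa only [ext_coe] using hasDerivAt_ext (f := f * g) (fun w => by simp [ext_coe])
    ((hf.hasDerivAt z).mul (hg.hasDerivAt z))

theorem Holo.mul (hf : Holo f) (hg : Holo g) : Holo (f * g) :=
  holo_of_hasDerivAt (hasDerivAt_ext_mul hf hg)

theorem Holo.sub (hf : Holo f) (hg : Holo g) : Holo (f - g) := by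
  rw [sub_eq_add_neg, ← neg_one_smul ℂ g]
  exact hf.add (hg.smul _)

theorem dderiv_sub (hf : Holo f) (hg : Holo g) (z : 𝔻) :
    dderiv (f - g) z = dderiv f z - dderiv g z := by
  rw [sub_eq_add_neg, ← neg_one_smul ℂ g, dderiv_add hf (hg.smul _), dderiv_smul _ hg]
  ring

theorem hasDerivAt_ext_one (z : 𝔻) : HasDerivAt (ext 1) 0 z :=
  hasDerivAt_ext (fun _ => rfl) (hasDerivAt_const _ 1)

theorem Holo.one : Holo 1 := holo_of_hasDerivAt hasDerivAt_ext_one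

theorem Holo.coe : Holo (fun z : 𝔻 => (z : ℂ)) :=
  holo_of_hasDerivAt fun z => hasDerivAt_ext (fun _ => rfl) (hasDerivAt_id (z : ℂ))

theorem hasDerivAt_ext_wComp (hu : Holo u) (hφ : Holo (fun z => (φ z : ℂ))) (hf : Holo f)
    (z : 𝔻) : HasDerivAt (ext (wComp u φ f)) (dderiv u z * f (φ z) +
      u z * (dderiv f (φ z) * dderiv (fun z => (φ z : ℂ)) z)) z := by
  have hfφ : HasDerivAt (ext f) (dderiv f (φ z)) (ext (fun z => (φ z : ℂ)) z) := by
    rw [ext_coe]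
    exact hf.hasDerivAt (φ z)
  simpa only [ext_coe, Function.comp] using
    hasDerivAt_ext (f := wComp u φ f) (fun w => by simp [ext_coe, wComp])
      ((hu.hasDerivAt z).mul (hfφ.comp (z : ℂ) (hφ.hasDerivAt z)))

theorem Holo.wComp (hu : Holo u) (hφ : Holo (fun z => (φ z : ℂ))) (hf : Holo f) :
    Holo (wComp u φ f) :=
  holo_of_hasDerivAt (hasDerivAt_ext_wComp hu hφ hf)

end Functions

/-! ### Disc automorphisms -/

/-- `1 - |z|²`, comparable to the distance from `z` to the unit circle. -/
def defect (z : 𝔻) : ℝ := 1 - ‖(z : ℂ)‖ ^ 2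

theorem defect_pos (z : 𝔻) : 0 < defect z := sub_pos.2 z.sq_norm_lt_one

theorem defect_le_one (z : 𝔻) : defect z ≤ 1 := sub_le_self _ (sq_nonneg _)

theorem coe_defect (z : 𝔻) : (defect z : ℂ) = 1 - conj (z : ℂ) * z := by
  rw [Complex.conj_mul', defect]
  push_cast
  ring

theorem one_sub_norm_le_norm (a z : 𝔻) : 1 - ‖(a : ℂ)‖ ≤ ‖1 - conj (a : ℂ) * z‖ := by
  have h := norm_sub_norm_le 1 (conj (a : ℂ) * z)
  rw [norm_one, norm_mul, Complex.norm_conj] at h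
  nlinarith [norm_nonneg (a : ℂ), z.norm_lt_one]

theorem norm_one_sub_conj_mul_pos (a z : 𝔻) : 0 < ‖1 - conj (a : ℂ) * z‖ :=
  (sub_pos.2 a.norm_lt_one).trans_le (one_sub_norm_le_norm a z)

theorem one_sub_conj_mul_ne_zero (a z : 𝔻) : 1 - conj (a : ℂ) * z ≠ 0 :=
  norm_pos_iff.1 (norm_one_sub_conj_mul_pos a z)

theorem defect_div_two_le_norm (a z : 𝔻) : defect a / 2 ≤ ‖1 - conj (a : ℂ) * z‖ := by
  refine le_trans ?_ (one_sub_norm_le_norm a z)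
  unfold defect
  nlinarith [norm_nonneg (a : ℂ), a.norm_lt_one]

theorem one_sub_norm_σ_sq (a z : 𝔻) :
    1 - ‖σ a z‖ ^ 2 = defect a * defect z / ‖1 - conj (a : ℂ) * z‖ ^ 2 := by
  have h := norm_one_sub_conj_mul_pos a z
  have key : ‖1 - conj (a : ℂ) * z‖ ^ 2 - ‖(a : ℂ) - z‖ ^ 2 = defect a * defect z := by
    simp only [defect, Complex.sq_norm, Complex.normSq_apply, Complex.sub_re, Complex.sub_im,
      Complex.mul_re, Complex.mul_im, Complex.conj_re, Complex.conj_im, Complex.one_re,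
      Complex.one_im]
    ring
  rw [← key, sub_div, div_self (pow_pos h 2).ne', σ, norm_div, div_pow]

theorem norm_σ_lt_one (a z : 𝔻) : ‖σ a z‖ < 1 := by
  have h : 0 < 1 - ‖σ a z‖ ^ 2 := by
    rw [one_sub_norm_σ_sq]
    exact div_pos (mul_pos (defect_pos a) (defect_pos z))
      (pow_pos (norm_one_sub_conj_mul_pos a z) 2)
  exact (sq_lt_one_iff₀ (norm_nonneg _)).1 (sub_pos.1 h)

theorem σ_self (a : 𝔻) : σ a a = 0 := by simp [σ]

theorem norm_σ_comm (a z : 𝔻) : ‖σ a z‖ = ‖σ z a‖ := by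
  rw [σ, σ, norm_div, norm_div, norm_sub_rev, ← Complex.norm_conj (1 - conj (a : ℂ) * z)]
  simp [mul_comm]

theorem one_sub_conj_mul_σ_sub (a z : 𝔻) :
    (1 - conj (a : ℂ) * z) * (σ a z - a) = -(defect a * z) := by
  have h := one_sub_conj_mul_ne_zero a z
  rw [σ, coe_defect]
  field_simp
  ring

/-- The disc automorphism `σ_a` as a self-map of the disc. -/
def σMap (a z : 𝔻) : 𝔻 := .mk (σ a z) (norm_σ_lt_one a z)

theorem coe_σMap (a z : 𝔻) : (σMap a z : ℂ) = σ a z := rfl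

theorem σ_σMap (a z : 𝔻) : σ a (σMap a z) = z := by
  have h := one_sub_conj_mul_ne_zero a z
  have ha : (defect a : ℂ) ≠ 0 := Complex.ofReal_ne_zero.2 (defect_pos a).ne'
  have hden : 1 - conj (a : ℂ) * σ a z = defect a / (1 - conj (a : ℂ) * z) := by
    rw [σ, coe_defect]
    field_simp
    ring
  rw [σ, coe_σMap, hden, div_eq_iff (div_ne_zero ha h), mul_div_assoc', eq_div_iff h]
  linear_combination -one_sub_conj_mul_σ_sub a z

theorem σMap_σMap (a z : 𝔻) : σMap a (σMap a z) = z :=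
  Complex.UnitDisc.coe_injective (σ_σMap a z)

theorem hasDerivAt_ext_σ (a z : 𝔻) :
    HasDerivAt (ext (σ a)) (-(defect a : ℂ) / (1 - conj (a : ℂ) * z) ^ 2) z := by
  have hnum : HasDerivAt (fun w : ℂ => (a : ℂ) - w) (-1) z := (hasDerivAt_id _).const_sub _
  have hden : HasDerivAt (fun w : ℂ => 1 - conj (a : ℂ) * w) (-conj (a : ℂ)) z := by
    simpa using ((hasDerivAt_id (z : ℂ)).const_mul (conj (a : ℂ))).const_sub 1
  refine (hasDerivAt_ext (fun _ => rfl)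
    (hnum.div hden (one_sub_conj_mul_ne_zero a z))).congr_deriv ?_
  rw [coe_defect]
  congr 1
  ring

theorem Holo.σ (a : 𝔻) : Holo (σ a) := holo_of_hasDerivAt (hasDerivAt_ext_σ a)

theorem pseudoDist_nonneg (z w : 𝔻) : 0 ≤ pseudoDist z w := norm_nonneg _

theorem pseudoDist_lt_one (z w : 𝔻) : pseudoDist z w < 1 := norm_σ_lt_one w z

theorem pseudoDist_comm (z w : 𝔻) : pseudoDist z w = pseudoDist w z := norm_σ_comm w z

theorem one_sub_pseudoDist_sq_le (z w : 𝔻) :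
    1 - pseudoDist z w ^ 2 ≤ 4 * defect z / defect w ^ 2 := by
  have hw := defect_pos w
  rw [pseudoDist, one_sub_norm_σ_sq]
  calc defect w * defect z / ‖1 - conj (w : ℂ) * z‖ ^ 2
      ≤ 1 * defect z / (defect w / 2) ^ 2 := by
        have := defect_div_two_le_norm w z
        have := defect_le_one w
        have := (defect_pos z).le
        gcongr
    _ = 4 * defect z / defect w ^ 2 := by
        field_simp
        ring

/-! ### The invariant derivative -/

/-- The derivative of `f` weighted by `1 - |w|²`: up to a unimodular factor, it is invariant under
disc automorphisms. -/
def invDeriv (f : 𝔻 → ℂ) (w : 𝔻) : ℂ := (defect w : ℂ) * dderiv f w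

theorem norm_invDeriv (f : 𝔻 → ℂ) (w : 𝔻) :
    ‖invDeriv f w‖ = (1 - ‖(w : ℂ)‖ ^ 2) * ‖dderiv f w‖ := by
  rw [invDeriv, norm_mul, Complex.norm_of_nonneg (defect_pos w).le, defect]

theorem invDeriv_mul {f g : 𝔻 → ℂ} (hf : Holo f) (hg : Holo g) (z : 𝔻) :
    invDeriv (f * g) z = invDeriv f z * g z + f z * invDeriv g z := by
  have h : dderiv (f * g) z = _ := (hasDerivAt_ext_mul hf hg z).deriv
  rw [invDeriv, invDeriv, invDeriv, h]
  ring

theorem invDeriv_sub {f g : 𝔻 → ℂ} (hf : Holo f) (hg : Holo g) (z : 𝔻) :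
    invDeriv (f - g) z = invDeriv f z - invDeriv g z := by
  rw [invDeriv, dderiv_sub hf hg, mul_sub, invDeriv, invDeriv]

theorem invDeriv_smul (c : ℂ) {f : 𝔻 → ℂ} (hf : Holo f) (z : 𝔻) :
    invDeriv (c • f) z = c * invDeriv f z := by
  rw [invDeriv, dderiv_smul c hf, mul_left_comm, invDeriv]

theorem invDeriv_one (z : 𝔻) : invDeriv 1 z = 0 := by
  have h : dderiv 1 z = _ := (hasDerivAt_ext_one z).deriv
  rw [invDeriv, h, mul_zero]

theorem invDeriv_σ (a w : 𝔻) :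
    invDeriv (σ a) w = -((defect a : ℂ) * defect w) / (1 - conj (a : ℂ) * w) ^ 2 := by
  have h : dderiv (σ a) w = _ := (hasDerivAt_ext_σ a w).deriv
  rw [invDeriv, h]
  ring

theorem invDeriv_σ_self (a : 𝔻) : invDeriv (σ a) a = -1 := by
  have h : (defect a : ℂ) ≠ 0 := Complex.ofReal_ne_zero.2 (defect_pos a).ne'
  rw [invDeriv_σ, ← coe_defect]
  field_simp

theorem norm_invDeriv_σ (a w : 𝔻) : ‖invDeriv (σ a) w‖ = 1 - ‖σ a w‖ ^ 2 := by
  rw [invDeriv_σ, one_sub_norm_σ_sq, norm_div, norm_neg, norm_mul, norm_pow,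
    Complex.norm_of_nonneg (defect_pos a).le, Complex.norm_of_nonneg (defect_pos w).le]

/-- The function `f ∘ σ_p`, which moves the behaviour of `f` at `p` to the origin. -/
def pullback (p : 𝔻) (f : 𝔻 → ℂ) : 𝔻 → ℂ := fun z => f (σMap p z)

theorem wComp_pullback (p : 𝔻) (f : 𝔻 → ℂ) : wComp 1 (σMap p) (pullback p f) = f := by
  funext w
  simp [wComp, pullback, σMap_σMap]

theorem Holo.pullback {f : 𝔻 → ℂ} (hf : Holo f) (p : 𝔻) : Holo (pullback p f) := by
  have h : BlochDiff.pullback p f = BlochDiff.wComp 1 (σMap p) f := by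
    funext w
    simp [BlochDiff.wComp, BlochDiff.pullback]
  rw [h]
  exact Holo.one.wComp (Holo.σ p) hf

theorem invDeriv_eq_dderiv_pullback {f : 𝔻 → ℂ} (hf : Holo f) (p w : 𝔻) :
    invDeriv f w = dderiv (pullback p f) (σMap p w) * invDeriv (σ p) w := by
  have h := (hasDerivAt_ext_wComp Holo.one (φ := σMap p) (Holo.σ p) (hf.pullback p) w).deriv
  have h1 : dderiv 1 w = 0 := (hasDerivAt_ext_one w).deriv
  rw [wComp_pullback, h1, zero_mul, zero_add, Pi.one_apply, one_mul] at h
  rw [invDeriv, invDeriv, dderiv, h]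
  exact mul_left_comm _ _ _

/-! ### Bounded analytic functions -/

namespace HInf

instance : FunLike HInf 𝔻 ℂ where
  coe f := (f : 𝔻 →ᵇ ℂ)
  coe_injective _ _ h := Subtype.ext (DFunLike.coe_injective h)

theorem holo (f : HInf) : Holo f := f.2

theorem coe_add (f g : HInf) : ⇑(f + g) = f + g := rfl

theorem coe_sub (f g : HInf) : ⇑(f - g) = f - g := rfl

theorem coe_smul (c : ℂ) (f : HInf) : ⇑(c • f) = c • ⇑f := rfl

theorem norm_apply_le (f : HInf) (z : 𝔻) : ‖f z‖ ≤ ‖f‖ :=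
  BoundedContinuousFunction.norm_coe_le_norm (f : 𝔻 →ᵇ ℂ) z

/-- A bounded analytic function as an element of `H^∞`. -/
def ofBound (f : 𝔻 → ℂ) (hf : Holo f) (M : ℝ) (hM : ∀ z, ‖f z‖ ≤ M) : HInf :=
  ⟨BoundedContinuousFunction.ofNormedAddCommGroup f hf.continuous M hM, hf⟩

theorem norm_ofBound_le {f : 𝔻 → ℂ} (hf : Holo f) {M : ℝ} (hM : ∀ z, ‖f z‖ ≤ M) :
    ‖ofBound f hf M hM‖ ≤ M :=
  (BoundedContinuousFunction.norm_le ((norm_nonneg _).trans (hM 0))).2 hM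

instance : CommMonoid HInf :=
  inferInstanceAs (CommMonoid (HInf.toSubalgebra Holo.one fun _ _ hf hg => Holo.mul hf hg))

theorem coe_one : ⇑(1 : HInf) = 1 := rfl

theorem coe_mul (f g : HInf) : ⇑(f * g) = f * g := rfl

theorem coe_pow (f : HInf) (n : ℕ) : ⇑(f ^ n) = ⇑f ^ n := rfl

theorem norm_mul_le (f g : HInf) : ‖f * g‖ ≤ ‖f‖ * ‖g‖ :=
  _root_.norm_mul_le (f : 𝔻 →ᵇ ℂ) g

theorem norm_mul_le_one {f g : HInf} (hf : ‖f‖ ≤ 1) (hg : ‖g‖ ≤ 1) : ‖f * g‖ ≤ 1 :=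
  (norm_mul_le f g).trans (mul_le_one₀ hf (norm_nonneg g) hg)

theorem norm_one_le : ‖(1 : HInf)‖ ≤ 1 :=
  (BoundedContinuousFunction.norm_le zero_le_one).2 fun _ => norm_one.le

theorem norm_pow_le_one {f : HInf} (hf : ‖f‖ ≤ 1) (n : ℕ) : ‖f ^ n‖ ≤ 1 := by
  induction n with
  | zero => simpa only [pow_zero] using norm_one_le
  | succ n ih =>
    rw [pow_succ]
    exact norm_mul_le_one ih hf

/-- The coordinate function `z`. -/
def coord : HInf := ofBound _ Holo.coe 1 fun z => z.norm_lt_one.le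

/-- The automorphism `σ_a` as an element of `H^∞`. -/
def moebius (a : 𝔻) : HInf := ofBound _ (Holo.σ a) 1 fun z => (norm_σ_lt_one a z).le

theorem coe_moebius (a : 𝔻) : ⇑(moebius a) = σ a := rfl

theorem norm_coord_le : ‖coord‖ ≤ 1 := norm_ofBound_le _ _

theorem norm_moebius_le (a : 𝔻) : ‖moebius a‖ ≤ 1 := norm_ofBound_le _ _

/-- The test function `(σ_a^{n+1} - a σ_a^n) σ_b^m` as an element of `H^∞`. -/
def test (n m : ℕ) (a b : 𝔻) : HInf :=
  (moebius a ^ (n + 1) - (a : ℂ) • moebius a ^ n) * moebius b ^ m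

theorem coe_test (n m : ℕ) (a b : 𝔻) : ⇑(test n m a b) = testFun n m a b := rfl

end HInf

/-! ### Pseudo-hyperbolic estimates -/

section Schwarz

open Metric

variable {h : ℂ → ℂ} {c ζ : ℂ} {R M : ℝ}

theorem mapsTo_closedBall_of_forall_norm_le (hR : 0 < R) (hM : ∀ ζ ∈ ball c R, ‖h ζ‖ ≤ M) :
    Set.MapsTo h (ball c R) (closedBall (h c) (2 * M)) := fun ζ hζ => by
  rw [mem_closedBall, two_mul]
  exact (dist_le_norm_add_norm _ _).trans (add_le_add (hM ζ hζ) (hM c (mem_ball_self hR)))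

theorem dist_le_of_forall_norm_le (hd : DifferentiableOn ℂ h (ball c R))
    (hM : ∀ ζ ∈ ball c R, ‖h ζ‖ ≤ M) (hζ : ζ ∈ ball c R) :
    dist (h ζ) (h c) ≤ 2 * M / R * dist ζ c :=
  Complex.dist_le_div_mul_dist_of_mapsTo_ball hd
    (mapsTo_closedBall_of_forall_norm_le (pos_of_mem_ball hζ) hM) hζ

theorem norm_deriv_le_of_forall_norm_le (hR : 0 < R) (hd : DifferentiableOn ℂ h (ball c R))
    (hM : ∀ ζ ∈ ball c R, ‖h ζ‖ ≤ M) : ‖deriv h c‖ ≤ 2 * M / R :=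
  Complex.norm_deriv_le_div_of_mapsTo_ball hd (mapsTo_closedBall_of_forall_norm_le hR hM) hR

theorem dist_deriv_le_of_forall_norm_le (hd : DifferentiableOn ℂ h (ball c R))
    (hM : ∀ ζ ∈ ball c R, ‖h ζ‖ ≤ M) (hζ : ζ ∈ ball c (R / 2)) :
    dist (deriv h ζ) (deriv h c) ≤ 16 * M / R ^ 2 * dist ζ c := by
  have hR : 0 < R / 2 := pos_of_mem_ball hζ
  have hsub {w : ℂ} (hw : w ∈ ball c (R / 2)) : ball w (R / 2) ⊆ ball c R :=
    ball_subset_ball' (by linarith [mem_ball.1 hw])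
  have hderiv : ∀ w ∈ ball c (R / 2), ‖deriv h w‖ ≤ 4 * M / R := fun w hw => by
    convert norm_deriv_le_of_forall_norm_le hR (hd.mono (hsub hw))
      fun ζ hζ => hM ζ (hsub hw hζ) using 1
    field_simp
    ring
  convert dist_le_of_forall_norm_le ((hd.deriv isOpen_ball).mono (hsub (mem_ball_self hR)))
    hderiv hζ using 1
  field_simp
  ring

end Schwarz

/-- The supremum of `|f|` over the pseudo-hyperbolic disc of radius `1 / 2` about `p`. -/
def localSup (f : HInf) (p : 𝔻) : ℝ := ⨆ w : {w : 𝔻 // pseudoDist w p < 1 / 2}, ‖f w‖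

section LocalSup

variable (f : HInf) (p q : 𝔻)

theorem localSup_nonneg : 0 ≤ localSup f p := Real.iSup_nonneg fun _ => norm_nonneg _

variable {f p} in
theorem localSup_le {M : ℝ} (hM : 0 ≤ M) (h : ∀ w, pseudoDist w p < 1 / 2 → ‖f w‖ ≤ M) :
    localSup f p ≤ M := Real.iSup_le (fun w => h w w.2) hM

theorem localSup_le_norm : localSup f p ≤ ‖f‖ :=
  localSup_le (norm_nonneg _) fun w _ => HInf.norm_apply_le f w

variable {p} in
theorem norm_le_localSup {w : 𝔻} (hw : pseudoDist w p < 1 / 2) : ‖f w‖ ≤ localSup f p :=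
  le_ciSup (f := fun w : {w : 𝔻 // pseudoDist w p < 1 / 2} => ‖f w‖)
    ⟨‖f‖, Set.forall_mem_range.2 fun w => HInf.norm_apply_le f w⟩ ⟨w, hw⟩

theorem norm_apply_le_localSup : ‖f p‖ ≤ localSup f p :=
  norm_le_localSup f (by rw [pseudoDist, σ_self, norm_zero]; norm_num)

theorem norm_ext_pullback_le {ζ : ℂ} (hζ : ζ ∈ Metric.ball (0 : ℂ) (1 / 2)) :
    ‖ext (pullback p f) ζ‖ ≤ localSup f p := by
  rw [mem_ball_zero_iff] at hζ
  lift ζ to 𝔻 using hζ.trans (by norm_num)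
  rw [ext_coe]
  exact norm_le_localSup f (by rwa [pseudoDist, σ_σMap])

theorem differentiableOn_ext_pullback :
    DifferentiableOn ℂ (ext (pullback p f)) (Metric.ball 0 (1 / 2)) :=
  DifferentiableOn.mono ((HInf.holo f).pullback p) (Metric.ball_subset_ball (by norm_num))

theorem σMap_self : σMap p p = 0 := Complex.UnitDisc.coe_injective (σ_self p)

theorem invDeriv_eq_neg_dderiv_pullback :
    invDeriv f p = -dderiv (pullback p f) 0 := by
  rw [invDeriv_eq_dderiv_pullback (HInf.holo f) p, invDeriv_σ_self, σMap_self, mul_neg_one]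

theorem norm_invDeriv_le : ‖invDeriv f p‖ ≤ 4 * localSup f p := by
  rw [invDeriv_eq_neg_dderiv_pullback, norm_neg]
  exact (norm_deriv_le_of_forall_norm_le (by norm_num) (differentiableOn_ext_pullback f p)
    fun _ => norm_ext_pullback_le f p).trans_eq (by ring)

theorem norm_apply_sub_apply_le :
    ‖f p - f q‖ ≤ 4 * (localSup f p + localSup f q) * pseudoDist p q := by
  have hp := localSup_nonneg f p
  have hq := localSup_nonneg f q
  rw [norm_sub_rev]
  by_cases hρ : pseudoDist p q < 1 / 2
  · have h := dist_le_of_forall_norm_le (differentiableOn_ext_pullback f p)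
      (fun _ => norm_ext_pullback_le f p) (ζ := σMap p q)
      (mem_ball_zero_iff.2 (by rwa [pseudoDist_comm] at hρ))
    rw [dist_zero_right, ext_coe, ← Complex.UnitDisc.coe_zero, ext_coe, pullback, pullback,
      σMap_σMap, ← σMap_self p, σMap_σMap, dist_eq_norm] at h
    refine h.trans ?_
    rw [pseudoDist_comm, coe_σMap, pseudoDist]
    gcongr
    linarith
  · have := norm_apply_le_localSup f p
    have := norm_apply_le_localSup f q
    calc ‖f q - f p‖ ≤ localSup f p + localSup f q := (norm_sub_le _ _).trans (by linarith)
      _ ≤ 4 * (localSup f p + localSup f q) * pseudoDist p q := by nlinarith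

theorem norm_invDeriv_transport_le : ‖invDeriv (σ p) q * invDeriv f p + invDeriv f q‖ ≤
    64 * (localSup f p + localSup f q) * pseudoDist p q := by
  have hp := localSup_nonneg f p
  have hq := localSup_nonneg f q
  have hσ : ‖invDeriv (σ p) q‖ ≤ 1 := by
    rw [norm_invDeriv_σ]
    linarith [sq_nonneg ‖σ p q‖]
  by_cases hρ : pseudoDist p q < 1 / 4
  · have h := dist_deriv_le_of_forall_norm_le (differentiableOn_ext_pullback f p)
      (fun _ => norm_ext_pullback_le f p) (ζ := σMap p q)
      (mem_ball_zero_iff.2 (by rw [pseudoDist_comm] at hρ; exact hρ.trans_eq (by norm_num)))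
    have heq : invDeriv (σ p) q * invDeriv f p + invDeriv f q =
        invDeriv (σ p) q * (dderiv (pullback p f) (σMap p q) - dderiv (pullback p f) 0) := by
      rw [invDeriv_eq_neg_dderiv_pullback, invDeriv_eq_dderiv_pullback (HInf.holo f) p q]
      ring
    rw [dist_zero_right, dist_eq_norm] at h
    rw [heq, norm_mul]
    refine (mul_le_of_le_one_left (norm_nonneg _) hσ).trans (h.trans ?_)
    rw [pseudoDist_comm, coe_σMap, pseudoDist]
    gcongr
    exact (by ring : _ = 64 * localSup f p).trans_le (by linarith)
  · have := norm_invDeriv_le f p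
    have := norm_invDeriv_le f q
    calc ‖invDeriv (σ p) q * invDeriv f p + invDeriv f q‖
        ≤ 1 * ‖invDeriv f p‖ + ‖invDeriv f q‖ := by
          refine (norm_add_le _ _).trans ?_
          rw [norm_mul]
          gcongr
      _ ≤ 4 * (localSup f p + localSup f q) := by linarith
      _ ≤ 64 * (localSup f p + localSup f q) * pseudoDist p q := by nlinarith

end LocalSup

/-! ### Differences of weighted composition operators -/

/-- The symbols of the weighted composition operator `u C_φ` are analytic. -/
structure HoloSymbols (u : 𝔻 → ℂ) (φ : 𝔻 → 𝔻) : Prop where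
  holo_weight : Holo u
  holo_map : Holo (fun z => (φ z : ℂ))

/-- The coefficient of the invariant derivative of `f` at `φ z` in the invariant derivative of
`u C_φ f` at `z`. -/
def compCoeff (u : 𝔻 → ℂ) (φ : 𝔻 → 𝔻) (z : 𝔻) : ℂ :=
  u z * invDeriv (fun w => (φ w : ℂ)) z / defect (φ z)

/-- The size of the coefficients of `u C_φ` at `z`, weighted by `ρ(φ z, ψ z)`. -/
def sepWeight (u : 𝔻 → ℂ) (φ ψ : 𝔻 → 𝔻) (z : 𝔻) : ℝ :=
  (‖invDeriv u z‖ + ‖compCoeff u φ z‖) * pseudoDist (φ z) (ψ z)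

/-- The defect of cancellation in `u C_φ - v C_ψ` at `z`: the functionals `f ↦ f(ψ z)` and
`f ↦ (1 - |ψ z|²) f'(ψ z)` are transported to `φ z` by means of `σ_{φ z}`. -/
def jetGap (u v : 𝔻 → ℂ) (φ ψ : 𝔻 → 𝔻) (z : 𝔻) : ℝ :=
  ‖invDeriv u z - invDeriv v z‖ +
    ‖compCoeff u φ z + compCoeff v ψ z * invDeriv (σ (φ z)) (ψ z)‖ + sepWeight v ψ φ z

section Operators

variable {u v f : 𝔻 → ℂ} {φ ψ : 𝔻 → 𝔻}

theorem HoloSymbols.holo_wComp (hu : HoloSymbols u φ) (hf : Holo f) : Holo (wComp u φ f) :=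
  hu.holo_weight.wComp hu.holo_map hf

theorem invDeriv_wComp (hu : HoloSymbols u φ) (hf : Holo f) (z : 𝔻) :
    invDeriv (wComp u φ f) z =
      invDeriv u z * f (φ z) + compCoeff u φ z * invDeriv f (φ z) := by
  have h : dderiv (wComp u φ f) z = _ :=
    (hasDerivAt_ext_wComp hu.holo_weight hu.holo_map hf z).deriv
  have hd : (defect (φ z) : ℂ) ≠ 0 := Complex.ofReal_ne_zero.2 (defect_pos _).ne'
  rw [invDeriv, h, compCoeff, invDeriv, invDeriv, invDeriv]
  field_simp

theorem invDeriv_wComp_sub (hu : HoloSymbols u φ) (hv : HoloSymbols v ψ) (hf : Holo f) (z : 𝔻) :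
    invDeriv ((wComp u φ - wComp v ψ) f) z =
      invDeriv u z * f (φ z) + compCoeff u φ z * invDeriv f (φ z) -
        (invDeriv v z * f (ψ z) + compCoeff v ψ z * invDeriv f (ψ z)) := by
  rw [LinearMap.sub_apply, invDeriv_sub (hu.holo_wComp hf) (hv.holo_wComp hf),
    invDeriv_wComp hu hf, invDeriv_wComp hv hf]

theorem wComp_sub_comm_apply (u v f : 𝔻 → ℂ) (φ ψ : 𝔻 → 𝔻) :
    (wComp v ψ - wComp u φ) f = (-1 : ℂ) • (wComp u φ - wComp v ψ) f := by
  rw [← neg_sub, LinearMap.neg_apply, neg_one_smul]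

theorem norm_invDeriv_wComp_sub_comm (hu : HoloSymbols u φ) (hv : HoloSymbols v ψ)
    (hf : Holo f) (z : 𝔻) : ‖invDeriv ((wComp v ψ - wComp u φ) f) z‖ =
      ‖invDeriv ((wComp u φ - wComp v ψ) f) z‖ := by
  rw [invDeriv_wComp_sub hu hv hf, invDeriv_wComp_sub hv hu hf, norm_sub_rev]

theorem weight_comm (φ ψ : 𝔻 → 𝔻) : weight φ ψ = weight ψ φ := by
  funext u z
  rw [weight, weight, pseudoDist_comm]

theorem norm_invDeriv_mul_σ (u : 𝔻 → ℂ) (φ ψ : 𝔻 → 𝔻) (z : 𝔻) :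
    ‖invDeriv u z * σ (ψ z) (φ z)‖ = weight φ ψ u z := by
  rw [norm_mul, norm_invDeriv, weight, pseudoDist]

theorem sepWeight_eq (u : 𝔻 → ℂ) (φ ψ : 𝔻 → 𝔻) (z : 𝔻) :
    sepWeight u φ ψ z = weight φ ψ u z + ‖compCoeff u φ z * σ (ψ z) (φ z)‖ := by
  rw [sepWeight, weight, norm_invDeriv, norm_mul, pseudoDist, add_mul]

theorem sepWeight_nonneg (u : 𝔻 → ℂ) (φ ψ : 𝔻 → 𝔻) (z : 𝔻) : 0 ≤ sepWeight u φ ψ z :=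
  mul_nonneg (by positivity) (pseudoDist_nonneg _ _)

theorem jetGap_nonneg (u v : 𝔻 → ℂ) (φ ψ : 𝔻 → 𝔻) (z : 𝔻) : 0 ≤ jetGap u v φ ψ z :=
  add_nonneg (by positivity) (sepWeight_nonneg v ψ φ z)

theorem norm_invDeriv_wComp_mul_le (hu : HoloSymbols u φ) (f : HInf) (z : 𝔻) :
    ‖invDeriv (wComp u φ f) z * σ (ψ z) (φ z)‖ ≤
      4 * (sepWeight u φ ψ z * localSup f (φ z)) := by
  have hf : ‖f (φ z)‖ ≤ 4 * localSup f (φ z) := by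
    linarith [norm_apply_le_localSup f (φ z), localSup_nonneg f (φ z)]
  rw [invDeriv_wComp hu (HInf.holo f), norm_mul]
  calc ‖invDeriv u z * f (φ z) + compCoeff u φ z * invDeriv f (φ z)‖ * ‖σ (ψ z) (φ z)‖
      ≤ (‖invDeriv u z‖ * ‖f (φ z)‖ + ‖compCoeff u φ z‖ * ‖invDeriv f (φ z)‖) *
          ‖σ (ψ z) (φ z)‖ := by
        gcongr
        exact norm_add_le_of_le (norm_mul_le _ _) (norm_mul_le _ _)
    _ ≤ (‖invDeriv u z‖ * (4 * localSup f (φ z)) +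
          ‖compCoeff u φ z‖ * (4 * localSup f (φ z))) * ‖σ (ψ z) (φ z)‖ := by
        gcongr
        exact norm_invDeriv_le f _
    _ = 4 * (sepWeight u φ ψ z * localSup f (φ z)) := by
        rw [sepWeight, pseudoDist]
        ring

theorem norm_invDeriv_wComp_sub_le (hu : HoloSymbols u φ) (hv : HoloSymbols v ψ) (f : HInf)
    (z : 𝔻) : ‖invDeriv ((wComp u φ - wComp v ψ) f) z‖ ≤
      64 * (jetGap u v φ ψ z * (localSup f (φ z) + localSup f (ψ z))) := by
  set p := φ z
  set q := ψ z
  set A := invDeriv u z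
  set B := invDeriv v z
  set C := compCoeff u φ z
  set D := compCoeff v ψ z
  set M := localSup f p + localSup f q
  have hp := localSup_nonneg f p
  have hq := localSup_nonneg f q
  have hfp : ‖f p‖ ≤ 64 * M := by linarith [norm_apply_le_localSup f p]
  have hdfp : ‖invDeriv f p‖ ≤ 64 * M := by linarith [norm_invDeriv_le f p]
  have hρM : 0 ≤ M * pseudoDist p q := mul_nonneg (by positivity) (pseudoDist_nonneg _ _)
  have hfpq : ‖f p - f q‖ ≤ 64 * M * pseudoDist p q := by
    linarith [norm_apply_sub_apply_le f p q]
  calc ‖invDeriv ((wComp u φ - wComp v ψ) f) z‖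
      = ‖(A - B) * f p + B * (f p - f q) + (C + D * invDeriv (σ p) q) * invDeriv f p -
          D * (invDeriv (σ p) q * invDeriv f p + invDeriv f q)‖ := by
        rw [invDeriv_wComp_sub hu hv (HInf.holo f)]
        congr 1
        ring
    _ ≤ ‖A - B‖ * ‖f p‖ + ‖B‖ * ‖f p - f q‖ + ‖C + D * invDeriv (σ p) q‖ * ‖invDeriv f p‖ +
          ‖D‖ * ‖invDeriv (σ p) q * invDeriv f p + invDeriv f q‖ := by
        simp only [← norm_mul]
        exact (norm_sub_le _ _).trans (add_le_add_left (norm_add₃_le ..) _)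
    _ ≤ ‖A - B‖ * (64 * M) + ‖B‖ * (64 * M * pseudoDist p q) +
          ‖C + D * invDeriv (σ p) q‖ * (64 * M) + ‖D‖ * (64 * M * pseudoDist p q) := by
        gcongr
        exact norm_invDeriv_transport_le f p q
    _ = 64 * (jetGap u v φ ψ z * M) := by
        rw [jetGap, sepWeight, pseudoDist_comm (ψ z)]
        ring

end Operators

/-! ### Coefficients from test functions -/

/-- The limit in condition (ii) of the theorem for the exponents `n` and `m`. -/
def TestVanish (u v : 𝔻 → ℂ) (φ ψ : 𝔻 → 𝔻) (n m : ℕ) : Prop :=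
  Tendsto (fun a : 𝔻 => ⨆ b : 𝔻, blochSemi ((wComp u φ - wComp v ψ) (testFun n m a b)))
    toBoundary (𝓝 0)

theorem invDeriv_σ_mul_self (a : 𝔻) {f : 𝔻 → ℂ} (hf : Holo f) :
    invDeriv (σ a * f) a = -f a := by
  rw [invDeriv_mul (Holo.σ a) hf, invDeriv_σ_self, σ_self]
  ring

theorem invDeriv_mul_σ_sq (f : 𝔻 → ℂ) (hf : Holo f) (a z : 𝔻) :
    invDeriv (f * σ a ^ 2) z =
      invDeriv f z * σ a z ^ 2 + f z * (2 * σ a z * invDeriv (σ a) z) := by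
  rw [invDeriv_mul hf (by rw [sq]; exact (Holo.σ a).mul (Holo.σ a)), sq (σ a),
    invDeriv_mul (Holo.σ a) (Holo.σ a)]
  simp only [Pi.mul_apply]
  ring

section TestJets

variable {u v : 𝔻 → ℂ} {φ ψ : 𝔻 → 𝔻}

theorem holo_σ_sub (a : 𝔻) : Holo (σ a - (a : ℂ) • 1) := (Holo.σ a).sub (Holo.one.smul _)

theorem testFun_zero_zero (a b : 𝔻) : testFun 0 0 a b = σ a - (a : ℂ) • 1 := by
  simp [testFun]

theorem testFun_zero_one (a b : 𝔻) : testFun 0 1 a b = (σ a - (a : ℂ) • 1) * σ b := by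
  simp [testFun]

theorem testFun_zero_two (a b : 𝔻) : testFun 0 2 a b = (σ a - (a : ℂ) • 1) * σ b ^ 2 := by
  simp [testFun]

theorem testFun_one_two (a b : 𝔻) :
    testFun 1 2 a b = (σ a * (σ a - (a : ℂ) • 1)) * σ b ^ 2 := by
  rw [testFun, mul_sub, mul_smul_comm, mul_one, pow_one, pow_succ, pow_one]

theorem invDeriv_σ_sub (a w : 𝔻) : invDeriv (σ a - (a : ℂ) • 1) w = invDeriv (σ a) w := by
  rw [invDeriv_sub (Holo.σ a) (Holo.one.smul _), invDeriv_smul _ Holo.one, invDeriv_one]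
  ring

theorem invDeriv_testFun_zero_zero (hu : HoloSymbols u φ) (hv : HoloSymbols v ψ) (z : 𝔻) :
    invDeriv ((wComp u φ - wComp v ψ) (testFun 0 0 (φ z) (φ z))) z =
      -((φ z : ℂ) * (invDeriv u z - invDeriv v z) +
        (compCoeff u φ z + compCoeff v ψ z * invDeriv (σ (φ z)) (ψ z)) +
        invDeriv v z * σ (φ z) (ψ z)) := by
  rw [testFun_zero_zero, invDeriv_wComp_sub hu hv (holo_σ_sub _), invDeriv_σ_sub, invDeriv_σ_sub,
    invDeriv_σ_self]
  simp only [Pi.sub_apply, Pi.smul_apply, Pi.one_apply, smul_eq_mul, mul_one, σ_self]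
  ring

theorem invDeriv_testFun_zero_one (hu : HoloSymbols u φ) (hv : HoloSymbols v ψ) (z : 𝔻) :
    invDeriv ((wComp u φ - wComp v ψ) (testFun 0 1 (φ z) (φ z))) z =
      (φ z : ℂ) * (compCoeff u φ z + compCoeff v ψ z * invDeriv (σ (φ z)) (ψ z)) -
        (invDeriv v z * σ (φ z) (ψ z) * (σ (φ z) (ψ z) - φ z) +
        compCoeff v ψ z * σ (φ z) (ψ z) * (2 * invDeriv (σ (φ z)) (ψ z))) := by
  rw [testFun_zero_one, invDeriv_wComp_sub hu hv ((holo_σ_sub _).mul (Holo.σ _)),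
    invDeriv_mul (holo_σ_sub _) (Holo.σ _), invDeriv_mul (holo_σ_sub _) (Holo.σ _),
    invDeriv_σ_sub, invDeriv_σ_sub, invDeriv_σ_self]
  simp only [Pi.sub_apply, Pi.smul_apply, Pi.one_apply, Pi.mul_apply, smul_eq_mul, mul_one, σ_self]
  ring

theorem invDeriv_wComp_sub_mul_σ_sq (hu : HoloSymbols u φ) (hv : HoloSymbols v ψ) (z : 𝔻)
    {f : 𝔻 → ℂ} (hf : Holo f) :
    invDeriv ((wComp u φ - wComp v ψ) (f * σ (ψ z) ^ 2)) z =
      (invDeriv u z * f (φ z) + compCoeff u φ z * invDeriv f (φ z)) * σ (ψ z) (φ z) ^ 2 +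
        compCoeff u φ z * f (φ z) *
          (2 * σ (ψ z) (φ z) * invDeriv (σ (ψ z)) (φ z)) := by
  rw [invDeriv_wComp_sub hu hv (hf.mul (by rw [sq]; exact (Holo.σ _).mul (Holo.σ _))),
    invDeriv_mul_σ_sq f hf, invDeriv_mul_σ_sq f hf]
  simp only [Pi.mul_apply, Pi.pow_apply, σ_self]
  ring

theorem invDeriv_testFun_zero_two (hu : HoloSymbols u φ) (hv : HoloSymbols v ψ) (z : 𝔻) :
    invDeriv ((wComp u φ - wComp v ψ) (testFun 0 2 (φ z) (ψ z))) z =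
      -((φ z : ℂ) * (invDeriv u z * σ (ψ z) (φ z) ^ 2 +
          2 * (compCoeff u φ z * σ (ψ z) (φ z) * invDeriv (σ (ψ z)) (φ z))) +
        compCoeff u φ z * σ (ψ z) (φ z) ^ 2) := by
  rw [testFun_zero_two, invDeriv_wComp_sub_mul_σ_sq hu hv z (holo_σ_sub _), invDeriv_σ_sub,
    invDeriv_σ_self]
  simp only [Pi.sub_apply, Pi.smul_apply, Pi.one_apply, smul_eq_mul, mul_one, σ_self]
  ring

theorem invDeriv_testFun_one_two (hu : HoloSymbols u φ) (hv : HoloSymbols v ψ) (z : 𝔻) :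
    invDeriv ((wComp u φ - wComp v ψ) (testFun 1 2 (φ z) (ψ z))) z =
      compCoeff u φ z * σ (ψ z) (φ z) ^ 2 * φ z := by
  rw [testFun_one_two, invDeriv_wComp_sub_mul_σ_sq hu hv z ((Holo.σ _).mul (holo_σ_sub _)),
    invDeriv_σ_mul_self _ (holo_σ_sub _)]
  simp only [Pi.sub_apply, Pi.smul_apply, Pi.one_apply, Pi.mul_apply, smul_eq_mul, mul_one, σ_self]
  ring

end TestJets

section Extraction

variable {ι : Type*} {l : Filter ι}

theorem tendsto_zero_of_mul_right {x y : ι → ℂ} {c : ℝ} (hc : c ≠ 0)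
    (hy : Tendsto (fun i => ‖y i‖) l (𝓝 c)) (hxy : Tendsto (fun i => x i * y i) l (𝓝 0)) :
    Tendsto x l (𝓝 0) := by
  rw [tendsto_zero_iff_norm_tendsto_zero] at hxy ⊢
  have h := hxy.mul (hy.inv₀ hc)
  rw [zero_mul] at h
  refine h.congr' ?_
  filter_upwards [hy.eventually_ne hc] with i hi
  rw [norm_mul, mul_inv_cancel_right₀ hi]

theorem tendsto_zero_mul_of_norm_le {𝕜 : Type*} [NonUnitalSeminormedRing 𝕜] {x y : ι → 𝕜}
    (R : ℝ) (hx : Tendsto x l (𝓝 0)) (hy : ∀ i, ‖y i‖ ≤ R) : Tendsto (fun i => x i * y i) l (𝓝 0) :=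
  hx.zero_mul_isBoundedUnder_le (isBoundedUnder_of ⟨R, hy⟩)

/-- Along an ultrafilter `s` has a limit, and the two hypotheses determine `A s` and `C s`
whether or not this limit is `0`: near `0` the factor `t` is invertible. -/
theorem tendsto_zero_of_quadratic {A C s t : ι → ℂ} (hs : ∀ i, ‖s i‖ ≤ 1)
    (ht : ∀ i, ‖t i‖ = 1 - ‖s i‖ ^ 2)
    (hC : Tendsto (fun i => C i * s i ^ 2) l (𝓝 0))
    (hAC : Tendsto (fun i => A i * s i ^ 2 + 2 * (C i * s i * t i)) l (𝓝 0))
    (hA : Tendsto (fun i => A i * s i) (l ⊓ comap (fun i => ‖s i‖) (𝓝 0)) (𝓝 0)) :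
    Tendsto (fun i => A i * s i) l (𝓝 0) ∧ Tendsto (fun i => C i * s i) l (𝓝 0) := by
  have ht' (i : ι) : ‖t i‖ ≤ 1 := by rw [ht]; linarith [sq_nonneg ‖s i‖]
  suffices h : ∀ 𝒰 : Ultrafilter ι, ↑𝒰 ≤ l →
      Tendsto (fun i => A i * s i) 𝒰 (𝓝 0) ∧ Tendsto (fun i => C i * s i) 𝒰 (𝓝 0) from
    ⟨(tendsto_iff_ultrafilter _ _ _).2 fun 𝒰 h𝒰 => (h 𝒰 h𝒰).1,
      (tendsto_iff_ultrafilter _ _ _).2 fun 𝒰 h𝒰 => (h 𝒰 h𝒰).2⟩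
  intro 𝒰 h𝒰
  obtain ⟨r, -, hr⟩ := (isCompact_Icc (a := (0 : ℝ)) (b := 1)).ultrafilter_le_nhds'
    (𝒰.map fun i => ‖s i‖)
    (show ∀ᶠ i in 𝒰, ‖s i‖ ∈ Set.Icc 0 1 from .of_forall fun i => ⟨norm_nonneg _, hs i⟩)
  replace hr : Tendsto (fun i => ‖s i‖) 𝒰 (𝓝 r) := hr
  replace hC := hC.mono_left h𝒰
  replace hAC := hAC.mono_left h𝒰
  rcases eq_or_ne r 0 with rfl | hr0
  · replace hA := hA.mono_left (le_inf h𝒰 (tendsto_iff_comap.1 hr))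
    have ht1 : Tendsto (fun i => ‖2 * t i‖) 𝒰 (𝓝 2) := by
      simpa [ht] using ((hr.pow 2).const_sub 1).const_mul 2
    refine ⟨hA, tendsto_zero_of_mul_right two_ne_zero ht1 ?_⟩
    simpa using (hAC.sub (tendsto_zero_mul_of_norm_le 1 hA hs)).congr fun i => by ring
  · have hr2 : Tendsto (fun i => ‖s i ^ 2‖) 𝒰 (𝓝 (r ^ 2)) := by simpa using hr.pow 2
    have hC0 := tendsto_zero_of_mul_right (pow_ne_zero 2 hr0) hr2 hC
    have hCs := tendsto_zero_mul_of_norm_le 1 hC0 hs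
    refine ⟨tendsto_zero_of_mul_right hr0 hr ?_, hCs⟩
    simpa using (hAC.sub ((tendsto_zero_mul_of_norm_le 1 hCs ht').const_mul 2)).congr
      fun i => by ring

end Extraction

section Limits

variable {u v : 𝔻 → ℂ} {φ ψ : 𝔻 → 𝔻} {l : Filter 𝔻} {n m : ℕ}

theorem tendsto_of_tendsto_ofReal_norm {ι : Type*} {l : Filter ι} {x : ι → ℂ}
    (h : Tendsto (fun i => ENNReal.ofReal ‖x i‖) l (𝓝 0)) : Tendsto x l (𝓝 0) := by
  rw [tendsto_zero_iff_norm_tendsto_zero]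
  exact ((ENNReal.tendsto_toReal ENNReal.zero_ne_top).comp h).congr fun i =>
    ENNReal.toReal_ofReal (norm_nonneg _)

theorem ofReal_norm_invDeriv_le (f : 𝔻 → ℂ) (z : 𝔻) :
    ENNReal.ofReal ‖invDeriv f z‖ ≤ blochSemi f := by
  rw [norm_invDeriv]
  exact le_iSup (fun z : 𝔻 => ENNReal.ofReal ((1 - ‖(z : ℂ)‖ ^ 2) * ‖dderiv f z‖)) z

theorem TestVanish.tendsto (h : TestVanish u v φ ψ n m) {a : 𝔻 → 𝔻}
    (ha : Tendsto a l toBoundary) (b : 𝔻 → 𝔻) :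
    Tendsto (fun z => invDeriv ((wComp u φ - wComp v ψ) (testFun n m (a z) (b z))) z) l (𝓝 0) := by
  refine tendsto_of_tendsto_ofReal_norm
    (tendsto_of_tendsto_of_tendsto_of_le_of_le tendsto_const_nhds (h.comp ha)
      (fun _ => zero_le) fun z => ?_)
  exact (ofReal_norm_invDeriv_le _ z).trans
    (le_iSup (fun b => blochSemi ((wComp u φ - wComp v ψ) (testFun n m (a z) b))) (b z))

theorem tendsto_norm_of_toBoundary {ι : Type*} {l : Filter ι} {p : ι → 𝔻}
    (hp : Tendsto p l toBoundary) : Tendsto (fun i => ‖(p i : ℂ)‖) l (𝓝 1) :=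
  (tendsto_comap (f := fun a : 𝔻 => ‖(a : ℂ)‖)).comp hp

theorem tendsto_sepWeight (hu : HoloSymbols u φ) (hv : HoloSymbols v ψ)
    (hB : Tendsto (weight φ ψ u) (rhoToZero φ ψ) (𝓝 0)) (h02 : TestVanish u v φ ψ 0 2)
    (h12 : TestVanish u v φ ψ 1 2) (hl : Tendsto φ l toBoundary) :
    Tendsto (sepWeight u φ ψ) l (𝓝 0) := by
  have hp := tendsto_norm_of_toBoundary hl
  have t02 := h02.tendsto hl ψ
  have t12 := h12.tendsto hl ψ
  simp only [invDeriv_testFun_zero_two hu hv, invDeriv_testFun_one_two hu hv] at t02 t12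
  have hC := tendsto_zero_of_mul_right one_ne_zero hp t12
  have hAC := tendsto_zero_of_mul_right one_ne_zero hp
    (x := fun z => invDeriv u z * σ (ψ z) (φ z) ^ 2 +
      2 * (compCoeff u φ z * σ (ψ z) (φ z) * invDeriv (σ (ψ z)) (φ z)))
    (by simpa using (t02.add hC).neg.congr fun z => by ring)
  have hA : Tendsto (fun z => invDeriv u z * σ (ψ z) (φ z)) (rhoToZero φ ψ) (𝓝 0) := by
    rw [tendsto_zero_iff_norm_tendsto_zero]
    simpa only [norm_invDeriv_mul_σ] using hB
  obtain ⟨hAs, hCs⟩ := tendsto_zero_of_quadratic (fun z => (norm_σ_lt_one _ _).le)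
    (fun z => norm_invDeriv_σ _ _) hC hAC (hA.mono_left inf_le_right)
  have h := hAs.norm.add hCs.norm
  simp only [norm_invDeriv_mul_σ, norm_zero, add_zero] at h
  exact h.congr fun z => (sepWeight_eq u φ ψ z).symm

theorem tendsto_jetGap (hu : HoloSymbols u φ) (hv : HoloSymbols v ψ)
    (h00 : TestVanish u v φ ψ 0 0) (h01 : TestVanish u v φ ψ 0 1) (hl : Tendsto φ l toBoundary)
    (hsep : Tendsto (sepWeight v ψ φ) l (𝓝 0)) : Tendsto (jetGap u v φ ψ) l (𝓝 0) := by
  have hp := tendsto_norm_of_toBoundary hl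
  have t00 := h00.tendsto hl φ
  have t01 := h01.tendsto hl φ
  simp only [invDeriv_testFun_zero_zero hu hv, invDeriv_testFun_zero_one hu hv] at t00 t01
  have hσ (z : 𝔻) : ‖σ (φ z) (ψ z) - φ z‖ ≤ 1 + 1 :=
    norm_sub_le_of_le (norm_σ_lt_one _ _).le (φ z).norm_lt_one.le
  have hσ' (z : 𝔻) : ‖2 * invDeriv (σ (φ z)) (ψ z)‖ ≤ 2 * 1 := by
    rw [norm_mul, Complex.norm_two, norm_invDeriv_σ]
    linarith [sq_nonneg ‖σ (φ z) (ψ z)‖]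
  have hB : Tendsto (fun z => invDeriv v z * σ (φ z) (ψ z)) l (𝓝 0) :=
    squeeze_zero_norm (fun z => by
      rw [sepWeight_eq, norm_invDeriv_mul_σ]
      exact le_add_of_nonneg_right (norm_nonneg _)) hsep
  have hD : Tendsto (fun z => compCoeff v ψ z * σ (φ z) (ψ z)) l (𝓝 0) :=
    squeeze_zero_norm (fun z => by
      rw [sepWeight_eq, ← norm_invDeriv_mul_σ]
      exact le_add_of_nonneg_left (norm_nonneg _)) hsep
  have hE := tendsto_zero_of_mul_right one_ne_zero hp
    (x := fun z => compCoeff u φ z + compCoeff v ψ z * invDeriv (σ (φ z)) (ψ z))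
    (by simpa using ((t01.add (tendsto_zero_mul_of_norm_le _ hB hσ)).add
      (tendsto_zero_mul_of_norm_le _ hD hσ')).congr fun z => by ring)
  have hAB := tendsto_zero_of_mul_right one_ne_zero hp
    (x := fun z => invDeriv u z - invDeriv v z)
    (by simpa using ((t00.add hE).add hB).neg.congr fun z => by ring)
  have h := (hAB.norm.add hE.norm).add hsep
  simp only [norm_zero, add_zero] at h
  exact h

end Limits

section Bounds

variable {u v : 𝔻 → ℂ} {φ ψ : 𝔻 → 𝔻} {K W : ℝ}

theorem norm_mul_add_norm_mul_le_of_quadratic {A C s t : ℂ} (hst : ‖s‖ ^ 2 + ‖t‖ = 1)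
    (hAs : ‖A * s‖ ≤ W) (hCs : ‖C * s ^ 2‖ ≤ K) (hACs : ‖A * s ^ 2 + 2 * (C * s * t)‖ ≤ K) :
    ‖A * s‖ + ‖C * s‖ ≤ 2 * K + 2 * W := by
  have hs : ‖s‖ ≤ 1 := (sq_le_one_iff₀ (norm_nonneg s)).1 (by linarith [norm_nonneg t])
  have hCst : 2 * ‖C * s * t‖ ≤ K + W := by
    calc 2 * ‖C * s * t‖ = ‖(A * s ^ 2 + 2 * (C * s * t)) - A * s * s‖ := by
          rw [← Complex.norm_two, ← norm_mul]
          congr 1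
          ring
      _ ≤ K + W := norm_sub_le_of_le hACs
          ((norm_mul_le _ _).trans ((mul_le_of_le_one_right (norm_nonneg _) hs).trans hAs))
  have hC : ‖C * s‖ ≤ ‖C * s ^ 2‖ + ‖C * s * t‖ :=
    calc ‖C * s‖ = ‖C * s ^ 2‖ * ‖s‖ + ‖C * s * t‖ := by
          simp only [norm_mul, norm_pow]
          linear_combination -(‖C‖ * ‖s‖) * hst
      _ ≤ ‖C * s ^ 2‖ + ‖C * s * t‖ := by
          gcongr
          exact mul_le_of_le_one_right (norm_nonneg _) hs
  linarith [norm_nonneg (C * s * t), (norm_nonneg _).trans hCs, (norm_nonneg _).trans hAs]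

theorem sepWeight_le (hu : HoloSymbols u φ) (hv : HoloSymbols v ψ)
    (hK : ∀ f : HInf, ‖f‖ ≤ 1 → ∀ z, ‖invDeriv ((wComp u φ - wComp v ψ) f) z‖ ≤ K)
    (hW : ∀ z, weight φ ψ u z ≤ W) (z : 𝔻) : sepWeight u φ ψ z ≤ 2 * K + 2 * W := by
  have hsq : ‖HInf.moebius (ψ z) ^ 2‖ ≤ 1 := HInf.norm_pow_le_one (HInf.norm_moebius_le _) 2
  rw [sepWeight_eq, ← norm_invDeriv_mul_σ]
  refine norm_mul_add_norm_mul_le_of_quadratic (t := invDeriv (σ (ψ z)) (φ z)) ?_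
    ((norm_invDeriv_mul_σ u φ ψ z).trans_le (hW z)) ?_ ?_
  · rw [norm_invDeriv_σ, add_sub_cancel]
  · refine le_trans (le_of_eq ?_)
      (hK _ (HInf.norm_mul_le_one (HInf.norm_moebius_le (φ z)) hsq) z)
    rw [HInf.coe_mul, HInf.coe_pow, HInf.coe_moebius, HInf.coe_moebius,
      invDeriv_wComp_sub_mul_σ_sq hu hv z (Holo.σ _), σ_self, invDeriv_σ_self, ← norm_neg]
    congr 1
    ring
  · refine le_trans (le_of_eq ?_) (hK _ (HInf.norm_mul_le_one HInf.norm_one_le hsq) z)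
    rw [HInf.coe_mul, HInf.coe_pow, HInf.coe_moebius, HInf.coe_one,
      invDeriv_wComp_sub_mul_σ_sq hu hv z Holo.one, invDeriv_one, Pi.one_apply]
    congr 1
    ring

theorem jetGap_le (hu : HoloSymbols u φ) (hv : HoloSymbols v ψ)
    (hK : ∀ f : HInf, ‖f‖ ≤ 1 → ∀ z, ‖invDeriv ((wComp u φ - wComp v ψ) f) z‖ ≤ K)
    (hW : ∀ z, weight φ ψ v z ≤ W) (z : 𝔻) : jetGap u v φ ψ z ≤ 4 * K + 3 * W := by
  have hAB : ‖invDeriv u z - invDeriv v z‖ ≤ K := by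
    refine le_trans (le_of_eq ?_) (hK 1 HInf.norm_one_le z)
    rw [HInf.coe_one, invDeriv_wComp_sub hu hv Holo.one, invDeriv_one, invDeriv_one]
    simp only [Pi.one_apply, mul_one, mul_zero, add_zero]
  have hE : ‖compCoeff u φ z + compCoeff v ψ z * invDeriv (σ (φ z)) (ψ z)‖ ≤ K + W := by
    have h := norm_add_le_of_le (hK _ (HInf.norm_moebius_le (φ z)) z)
      ((norm_invDeriv_mul_σ v ψ φ z).trans_le (weight_comm ψ φ ▸ hW z))
    refine le_trans (le_of_eq ?_) h
    rw [HInf.coe_moebius, invDeriv_wComp_sub hu hv (Holo.σ _), σ_self, invDeriv_σ_self, ← norm_neg]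
    congr 1
    ring
  have hsep : sepWeight v ψ φ z ≤ 2 * K + 2 * W :=
    sepWeight_le hv hu
      (fun f hf z => (norm_invDeriv_wComp_sub_comm hu hv (HInf.holo f) z).trans_le (hK f hf z))
      (weight_comm ψ φ ▸ hW) z
  rw [jetGap]
  linarith

end Bounds

/-! ### Jet conditions for compactness -/

/-- Conditions on the coefficients of `u C_φ - v C_ψ` under which this operator is compact: the
coefficients are bounded, those of either operator weighted by `ρ` vanish where its symbol
approaches the unit circle, and the two operators cancel where both symbols approach it. -/
structure VanishingJets (u v : 𝔻 → ℂ) (φ ψ : 𝔻 → 𝔻) : Prop where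
  exists_sepWeight_left_le : ∃ W, ∀ z, sepWeight u φ ψ z ≤ W
  exists_sepWeight_right_le : ∃ W, ∀ z, sepWeight v ψ φ z ≤ W
  exists_jetGap_le : ∃ J, ∀ z, jetGap u v φ ψ z ≤ J
  tendsto_sepWeight_left : Tendsto (sepWeight u φ ψ) (comap φ toBoundary) (𝓝 0)
  tendsto_sepWeight_right : Tendsto (sepWeight v ψ φ) (comap ψ toBoundary) (𝓝 0)
  tendsto_jetGap : Tendsto (jetGap u v φ ψ) (comap φ toBoundary ⊓ comap ψ toBoundary) (𝓝 0)

section VanishingJets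

variable {u v : 𝔻 → ℂ} {φ ψ : 𝔻 → 𝔻} {n m : ℕ}

theorem TestVanish.symm (hu : HoloSymbols u φ) (hv : HoloSymbols v ψ)
    (h : TestVanish u v φ ψ n m) : TestVanish v u ψ φ n m := by
  refine h.congr fun a => iSup_congr fun b => ?_
  have hf := HInf.holo (HInf.test n m a b)
  rw [HInf.coe_test] at hf
  rw [wComp_sub_comm_apply u, LinearMap.sub_apply,
    blochSemi_smul _ ((hu.holo_wComp hf).sub (hv.holo_wComp hf)), norm_neg, norm_one,
    ENNReal.ofReal_one, one_mul]

theorem rhoToZero_comm (φ ψ : 𝔻 → 𝔻) : rhoToZero φ ψ = rhoToZero ψ φ := by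
  simp only [rhoToZero, pseudoDist_comm]

theorem vanishingJets_of_testVanish {K : ℝ} (hu : HoloSymbols u φ) (hv : HoloSymbols v ψ)
    (hA : CondA u v φ ψ) (hB : CondB u v φ ψ)
    (hK : ∀ f : HInf, ‖f‖ ≤ 1 → ∀ z, ‖invDeriv ((wComp u φ - wComp v ψ) f) z‖ ≤ K)
    (h00 : TestVanish u v φ ψ 0 0) (h01 : TestVanish u v φ ψ 0 1) (h02 : TestVanish u v φ ψ 0 2)
    (h12 : TestVanish u v φ ψ 1 2) : VanishingJets u v φ ψ := by
  obtain ⟨W, hW⟩ := hA.1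
  obtain ⟨W', hW'⟩ := hA.2
  have hsymm (f : HInf) (hf : ‖f‖ ≤ 1) (z : 𝔻) : ‖invDeriv ((wComp v ψ - wComp u φ) f) z‖ ≤ K :=
    (norm_invDeriv_wComp_sub_comm hu hv (HInf.holo f) z).trans_le (hK f hf z)
  have hBv : Tendsto (weight ψ φ v) (rhoToZero ψ φ) (𝓝 0) := by
    rw [weight_comm, rhoToZero_comm]
    exact hB.2
  have hsepv := tendsto_sepWeight hv hu hBv (h02.symm hu hv) (h12.symm hu hv)
    (tendsto_comap (f := ψ))
  exact
    { exists_sepWeight_left_le := ⟨_, sepWeight_le hu hv hK fun z => hW ⟨z, rfl⟩⟩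
      exists_sepWeight_right_le :=
        ⟨_, sepWeight_le hv hu hsymm fun z => weight_comm φ ψ ▸ hW' ⟨z, rfl⟩⟩
      exists_jetGap_le := ⟨_, jetGap_le hu hv hK fun z => hW' ⟨z, rfl⟩⟩
      tendsto_sepWeight_left := tendsto_sepWeight hu hv hB.1 h02 h12 tendsto_comap
      tendsto_sepWeight_right := hsepv
      tendsto_jetGap := tendsto_jetGap hu hv h00 h01 (tendsto_comap.mono_left inf_le_left)
        (hsepv.mono_left inf_le_right) }

end VanishingJets

section BoundaryAndInterior

variable {ι : Type*} {l : Filter ι} {F : ι → HInf} {p q : ι → 𝔻} {r : ℝ}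

theorem tendsto_toBoundary_iff :
    Tendsto p l toBoundary ↔ Tendsto (fun i => defect (p i)) l (𝓝 0) := by
  refine ⟨fun h => ?_, fun h => tendsto_comap_iff.2 ?_⟩
  · have hp := ((tendsto_norm_of_toBoundary h).pow 2).const_sub 1
    rw [one_pow, sub_self] at hp
    exact hp
  · have hp := (h.const_sub 1).sqrt
    simpa only [defect, sub_sub_cancel, Real.sqrt_sq (norm_nonneg _), sub_zero, Real.sqrt_one,
      Function.comp_def] using hp

theorem tendsto_toBoundary_or_eventually_le_defect (𝒰 : Ultrafilter ι) (p : ι → 𝔻) :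
    Tendsto p 𝒰 toBoundary ∨ ∃ r > 0, ∀ᶠ i in 𝒰, r ≤ defect (p i) := by
  rw [tendsto_toBoundary_iff, or_iff_not_imp_right]
  intro h
  refine tendsto_order.2 ⟨fun r hr => .of_forall fun i => hr.trans (defect_pos _), fun r hr => ?_⟩
  have hr' : ¬∀ᶠ i in 𝒰, r ≤ defect (p i) := fun hr' => h ⟨r, hr, hr'⟩
  simpa only [not_le] using Ultrafilter.eventually_not.2 hr'

theorem isCompact_setOf_le_defect (hr : 0 < r) : IsCompact {z : 𝔻 | r ≤ defect z} := by
  rw [Complex.UnitDisc.isEmbedding_coe.isCompact_iff]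
  have himage : (fun z : 𝔻 => (z : ℂ)) '' {z | r ≤ defect z} = {w : ℂ | r ≤ 1 - ‖w‖ ^ 2} := by
    ext w
    refine ⟨fun ⟨_, hz, hzw⟩ => hzw ▸ hz, fun hw => ?_⟩
    lift w to 𝔻 using (sq_lt_one_iff₀ (norm_nonneg w)).1 (by linarith [hw.out])
    exact ⟨w, hw, rfl⟩
  rw [himage]
  refine (isCompact_closedBall (0 : ℂ) 1).of_isClosed_subset
    (isClosed_le continuous_const (by fun_prop)) fun w hw => ?_
  rw [mem_closedBall_zero_iff, ← sq_le_one_iff₀ (norm_nonneg w)]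
  linarith [hw.out]

theorem le_defect_of_pseudoDist_lt {w z : 𝔻} (h : pseudoDist w z < 1 / 2) :
    3 / 16 * defect z ^ 2 ≤ defect w := by
  have hz := defect_pos z
  have hρ : 3 / 4 ≤ 4 * defect w / defect z ^ 2 :=
    le_trans (by nlinarith [pseudoDist_nonneg w z]) (one_sub_pseudoDist_sq_le w z)
  rw [le_div_iff₀ (by positivity)] at hρ
  linarith

theorem tendsto_localSup (hF : TendstoLocallyUniformly (fun i => ⇑(F i)) 0 l)
    (hr : 0 < r) (hp : ∀ᶠ i in l, r ≤ defect (p i)) :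
    Tendsto (fun i => localSup (F i) (p i)) l (𝓝 0) := by
  have hunif := (tendstoLocallyUniformlyOn_iff_tendstoUniformlyOn_of_compact
    (isCompact_setOf_le_defect (r := 3 / 16 * r ^ 2) (by positivity))).1
    hF.tendstoLocallyUniformlyOn
  refine Metric.nhds_basis_closedBall.tendsto_right_iff.2 fun ε hε => ?_
  filter_upwards [hp, Metric.tendstoUniformlyOn_iff.1 hunif ε hε] with i hi hFi
  rw [mem_closedBall_zero_iff, Real.norm_of_nonneg (localSup_nonneg _ _)]
  refine localSup_le hε.le fun w hw => ?_
  have hw' : 3 / 16 * r ^ 2 ≤ defect w := by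
    refine le_trans ?_ (le_defect_of_pseudoDist_lt hw)
    gcongr
  simpa only [Pi.zero_apply, dist_zero_left] using (hFi w hw').le

theorem tendsto_pseudoDist_one (hp : Tendsto p l toBoundary) (hr : 0 < r)
    (hq : ∀ᶠ i in l, r ≤ defect (q i)) :
    Tendsto (fun i => pseudoDist (p i) (q i)) l (𝓝 1) := by
  have hlower := ((tendsto_toBoundary_iff.1 hp).const_mul (4 / r ^ 2)).const_sub 1
  rw [mul_zero, sub_zero] at hlower
  refine tendsto_of_tendsto_of_tendsto_of_le_of_le' hlower tendsto_const_nhds ?_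
    (.of_forall fun i => (pseudoDist_lt_one _ _).le)
  filter_upwards [hq] with i hi
  have hbound : 4 * defect (p i) / defect (q i) ^ 2 ≤ 4 / r ^ 2 * defect (p i) := by
    rw [div_mul_eq_mul_div]
    have := (defect_pos (p i)).le
    gcongr
  nlinarith [one_sub_pseudoDist_sq_le (p i) (q i), pseudoDist_nonneg (p i) (q i),
    pseudoDist_lt_one (p i) (q i)]

end BoundaryAndInterior

section Sufficiency

variable {u v : 𝔻 → ℂ} {φ ψ : 𝔻 → 𝔻} {ι : Type*} {l : Filter ι} {F : ι → HInf} {z : ι → 𝔻}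

theorem tendsto_mul_localSup_of_le {s : ι → ℝ} {p : ι → 𝔻} {R : ℝ} (hs : Tendsto s l (𝓝 0))
    (hF : ∀ i, ‖F i‖ ≤ R) : Tendsto (fun i => s i * localSup (F i) (p i)) l (𝓝 0) :=
  tendsto_zero_mul_of_norm_le R hs fun i =>
    (Real.norm_of_nonneg (localSup_nonneg _ _)).trans_le ((localSup_le_norm _ _).trans (hF i))

theorem tendsto_mul_localSup_of_eventually_le_defect {s : ι → ℝ} {p : ι → 𝔻} {r W : ℝ}
    (hs : ∀ i, 0 ≤ s i) (hsW : ∀ i, s i ≤ W)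
    (hF : TendstoLocallyUniformly (fun i => ⇑(F i)) 0 l) (hr : 0 < r)
    (hp : ∀ᶠ i in l, r ≤ defect (p i)) :
    Tendsto (fun i => s i * localSup (F i) (p i)) l (𝓝 0) :=
  (tendsto_zero_mul_of_norm_le W (tendsto_localSup hF hr hp) fun i =>
    (Real.norm_of_nonneg (hs i)).trans_le (hsW i)).congr fun _ => mul_comm _ _

theorem tendsto_invDeriv_wComp (hu : HoloSymbols u φ)
    (hρ : Tendsto (fun i => pseudoDist (φ (z i)) (ψ (z i))) l (𝓝 1))
    (h : Tendsto (fun i => sepWeight u φ ψ (z i) * localSup (F i) (φ (z i))) l (𝓝 0)) :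
    Tendsto (fun i => invDeriv (wComp u φ (F i)) (z i)) l (𝓝 0) := by
  refine tendsto_zero_of_mul_right (y := fun i => σ (ψ (z i)) (φ (z i))) one_ne_zero hρ
    (squeeze_zero_norm (fun i => norm_invDeriv_wComp_mul_le hu (F i) (z i)) ?_)
  simpa only [mul_zero] using h.const_mul 4

theorem tendsto_invDeriv_of_boundary_of_interior {r R : ℝ} (hu : HoloSymbols u φ)
    (hv : HoloSymbols v ψ) (hsu : Tendsto (sepWeight u φ ψ) (comap φ toBoundary) (𝓝 0))
    (hsv : ∃ W, ∀ z, sepWeight v ψ φ z ≤ W) (hFR : ∀ i, ‖F i‖ ≤ R)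
    (hF : TendstoLocallyUniformly (fun i => ⇑(F i)) 0 l)
    (hφ : Tendsto (fun i => φ (z i)) l toBoundary) (hr : 0 < r)
    (hψ : ∀ᶠ i in l, r ≤ defect (ψ (z i))) :
    Tendsto (fun i => invDeriv ((wComp u φ - wComp v ψ) (F i)) (z i)) l (𝓝 0) := by
  obtain ⟨W, hW⟩ := hsv
  have hρ := tendsto_pseudoDist_one hφ hr hψ
  have hu0 := tendsto_invDeriv_wComp hu hρ
    (tendsto_mul_localSup_of_le (hsu.comp (tendsto_comap_iff.2 hφ)) hFR)
  have hρ' : Tendsto (fun i => pseudoDist (ψ (z i)) (φ (z i))) l (𝓝 1) :=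
    hρ.congr fun i => pseudoDist_comm _ _
  have hv0 := tendsto_invDeriv_wComp hv hρ' (tendsto_mul_localSup_of_eventually_le_defect
    (fun i => sepWeight_nonneg v ψ φ (z i)) (fun i => hW (z i)) hF hr hψ)
  rw [← sub_zero (0 : ℂ)]
  refine (hu0.sub hv0).congr fun i => ?_
  have hf := HInf.holo (F i)
  rw [LinearMap.sub_apply, invDeriv_sub (hu.holo_wComp hf) (hv.holo_wComp hf)]

theorem tendsto_invDeriv_of_jetGap (hu : HoloSymbols u φ) (hv : HoloSymbols v ψ)
    (hφ : Tendsto (fun i => jetGap u v φ ψ (z i) * localSup (F i) (φ (z i))) l (𝓝 0))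
    (hψ : Tendsto (fun i => jetGap u v φ ψ (z i) * localSup (F i) (ψ (z i))) l (𝓝 0)) :
    Tendsto (fun i => invDeriv ((wComp u φ - wComp v ψ) (F i)) (z i)) l (𝓝 0) := by
  refine squeeze_zero_norm (fun i => norm_invDeriv_wComp_sub_le hu hv (F i) (z i)) ?_
  simpa only [mul_add, add_zero, mul_zero] using (hφ.add hψ).const_mul 64

theorem VanishingJets.tendsto_invDeriv {R : ℝ} (h : VanishingJets u v φ ψ)
    (hu : HoloSymbols u φ) (hv : HoloSymbols v ψ) (hFR : ∀ i, ‖F i‖ ≤ R)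
    (hF : TendstoLocallyUniformly (fun i => ⇑(F i)) 0 l) :
    Tendsto (fun i => invDeriv ((wComp u φ - wComp v ψ) (F i)) (z i)) l (𝓝 0) := by
  refine (tendsto_iff_ultrafilter _ _ _).2 fun 𝒰 h𝒰 => ?_
  replace hF : TendstoLocallyUniformly (fun i => ⇑(F i)) 0 (𝒰 : Filter ι) :=
    fun V hV x => (hF V hV x).imp fun t ht => ⟨ht.1, h𝒰 ht.2⟩
  rcases tendsto_toBoundary_or_eventually_le_defect 𝒰 (fun i => φ (z i)) with hφ | ⟨r, hr, hφ⟩ <;>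
    rcases tendsto_toBoundary_or_eventually_le_defect 𝒰 (fun i => ψ (z i)) with
      hψ | ⟨r', hr', hψ⟩
  · have hJ := h.tendsto_jetGap.comp
      (tendsto_inf.2 ⟨tendsto_comap_iff.2 hφ, tendsto_comap_iff.2 hψ⟩)
    exact tendsto_invDeriv_of_jetGap hu hv (tendsto_mul_localSup_of_le hJ hFR)
      (tendsto_mul_localSup_of_le hJ hFR)
  · exact tendsto_invDeriv_of_boundary_of_interior hu hv h.tendsto_sepWeight_left
      h.exists_sepWeight_right_le hFR hF hφ hr' hψ
  · have hswap := tendsto_invDeriv_of_boundary_of_interior hv hu h.tendsto_sepWeight_right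
      h.exists_sepWeight_left_le hFR hF hψ hr hφ
    rw [tendsto_zero_iff_norm_tendsto_zero] at hswap ⊢
    exact hswap.congr fun i => norm_invDeriv_wComp_sub_comm hu hv (HInf.holo (F i)) (z i)
  · obtain ⟨J, hJ⟩ := h.exists_jetGap_le
    have hJ0 (i : ι) := jetGap_nonneg u v φ ψ (z i)
    exact tendsto_invDeriv_of_jetGap hu hv
      (tendsto_mul_localSup_of_eventually_le_defect hJ0 (fun i => hJ (z i)) hF hr hφ)
      (tendsto_mul_localSup_of_eventually_le_defect hJ0 (fun i => hJ (z i)) hF hr' hψ)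

theorem VanishingJets.tendstoUniformly {R : ℝ} (h : VanishingJets u v φ ψ)
    (hu : HoloSymbols u φ) (hv : HoloSymbols v ψ) (hFR : ∀ i, ‖F i‖ ≤ R)
    (hF : TendstoLocallyUniformly (fun i => ⇑(F i)) 0 l) :
    TendstoUniformly (fun i => invDeriv ((wComp u φ - wComp v ψ) (F i))) 0 l :=
  tendsto_prod_top_iff.1 <| h.tendsto_invDeriv hu hv (fun i => hFR i.1)
    fun V hV x => (hF V hV x).imp fun _ ht => ⟨ht.1, tendsto_fst.eventually ht.2⟩

end Sufficiency

/-! ### Normal families -/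

section Montel

variable {ι : Type*} {l : Filter ι} {F : ι → HInf} {g : 𝔻 → ℂ} {R : ℝ}

theorem HInf.dist_apply_le (f : HInf) (hf : ‖f‖ ≤ R) (z w : 𝔻) :
    dist (f z) (f w) ≤ 8 * R * pseudoDist z w := by
  rw [dist_eq_norm]
  refine (norm_apply_sub_apply_le f z w).trans
    (mul_le_mul_of_nonneg_right ?_ (pseudoDist_nonneg z w))
  linarith [localSup_le_norm f z, localSup_le_norm f w]

theorem tendsto_pseudoDist_nhds (z : 𝔻) : Tendsto (fun w => pseudoDist w z) (𝓝 z) (𝓝 0) := by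
  simpa only [pseudoDist, σ_self, norm_zero] using ((Holo.σ z).continuous.tendsto z).norm

theorem tendstoLocallyUniformly_of_tendsto_apply [l.NeBot] (hF : ∀ i, ‖F i‖ ≤ R)
    (hg : ∀ z, Tendsto (fun i => F i z) l (𝓝 (g z))) :
    TendstoLocallyUniformly (fun i => ⇑(F i)) g l := by
  have hgdist (z w : 𝔻) : dist (g z) (g w) ≤ 8 * R * pseudoDist z w :=
    le_of_tendsto ((hg z).dist (hg w)) (.of_forall fun i => HInf.dist_apply_le (F i) (hF i) z w)
  refine tendstoLocallyUniformly_iff_forall_tendsto.2 fun z =>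
    tendsto_uniformity_iff_dist_tendsto_zero.2 ?_
  have hbound (p : ι × 𝔻) : dist (g p.2) (F p.1 p.2) ≤
      2 * (8 * R * pseudoDist p.2 z) + dist (g z) (F p.1 z) := by
    have htri := dist_triangle4 (g p.2) (g z) (F p.1 z) (F p.1 p.2)
    have hFdist := HInf.dist_apply_le (F p.1) (hF p.1) p.2 z
    rw [dist_comm] at hFdist
    linarith [hgdist p.2 z]
  refine squeeze_zero (fun _ => dist_nonneg) hbound ?_
  have hρ : Tendsto (fun p : ι × 𝔻 => pseudoDist p.2 z) (l ×ˢ 𝓝 z) (𝓝 0) :=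
    (tendsto_pseudoDist_nhds z).comp tendsto_snd
  have hz : Tendsto (fun p : ι × 𝔻 => dist (g z) (F p.1 z)) (l ×ˢ 𝓝 z) (𝓝 0) := by
    rw [← dist_self (g z)]
    exact tendsto_const_nhds.dist ((hg z).comp tendsto_fst)
  simpa only [mul_zero, add_zero] using ((hρ.const_mul (8 * R)).const_mul 2).add hz

theorem holo_of_tendstoLocallyUniformly {f : ι → 𝔻 → ℂ} [l.NeBot] (hf : ∀ i, Holo (f i))
    (h : TendstoLocallyUniformly f g l) : Holo g := by
  have hcont : Continuous fun w : Metric.ball (0 : ℂ) 1 =>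
      Complex.UnitDisc.mk w (mem_ball_zero_iff.1 w.2) :=
    Complex.UnitDisc.isEmbedding_coe.continuous_iff.2 continuous_subtype_val
  have hext : TendstoLocallyUniformlyOn (fun i => ext (f i)) (ext g) l (Metric.ball 0 1) := by
    rw [tendstoLocallyUniformlyOn_iff_tendstoLocallyUniformly_comp_coe]
    convert h.comp _ hcont using 2 with i
    all_goals exact funext fun w => ext_coe _ (Complex.UnitDisc.mk w (mem_ball_zero_iff.1 w.2))
  exact hext.differentiableOn (.of_forall hf) Metric.isOpen_ball

/-- Montel's theorem. -/
theorem exists_tendstoLocallyUniformly (𝒰 : Ultrafilter ι) (hF : ∀ i, ‖F i‖ ≤ R) :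
    ∃ f : HInf, ‖f‖ ≤ R ∧ TendstoLocallyUniformly (fun i => ⇑(F i)) f 𝒰 := by
  have hlim (z : 𝔻) : ∃ c ∈ Metric.closedBall (0 : ℂ) R, Tendsto (fun i => F i z) 𝒰 (𝓝 c) :=
    (isCompact_closedBall (0 : ℂ) R).ultrafilter_le_nhds (𝒰.map fun i => F i z) <|
      le_principal_iff.2 <| Filter.mem_map.2 <| Eventually.of_forall fun i =>
        mem_closedBall_zero_iff.2 ((HInf.norm_apply_le (F i) z).trans (hF i))
  choose g hgR hg using hlim
  have hunif := tendstoLocallyUniformly_of_tendsto_apply hF hg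
  have hholo := holo_of_tendstoLocallyUniformly (fun i => HInf.holo (F i)) hunif
  exact ⟨HInf.ofBound g hholo R fun z => mem_closedBall_zero_iff.1 (hgR z),
    HInf.norm_ofBound_le hholo _, hunif⟩

end Montel

theorem isCompactOperator_of_tendsto_zero {E : Type*} [NormedAddCommGroup E] [NormedSpace ℂ E]
    {T : HInf →L[ℂ] E}
    (h : ∀ (𝒰 : Ultrafilter (Metric.closedBall (0 : HInf) 1))
      (F : Metric.closedBall (0 : HInf) 1 → HInf), (∀ i, ‖F i‖ ≤ 2) →
      TendstoLocallyUniformly (fun i => ⇑(F i)) 0 𝒰 → Tendsto (fun i => T (F i)) 𝒰 (𝓝 0)) :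
    IsCompactOperator T := by
  refine (isCompactOperator_iff_image_closedBall_subset_compact (T : HInf →ₗ[ℂ] E)
    one_pos).2 ⟨_, isCompact_iff_ultrafilter_le_nhds'.2 fun 𝒲 h𝒲 => ?_, subset_rfl⟩
  rw [Set.image_eq_range] at h𝒲
  obtain ⟨𝒰, rfl⟩ : ∃ 𝒰 : Ultrafilter (Metric.closedBall (0 : HInf) 1),
      𝒰.map (fun f : Metric.closedBall (0 : HInf) 1 => T f) = 𝒲 :=
    ⟨.ofComapInfPrincipal (s := Set.univ) (by rwa [Set.image_univ]),
      Ultrafilter.ofComapInfPrincipal_eq_of_map _⟩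
  have hball (i : Metric.closedBall (0 : HInf) 1) : ‖(i : HInf)‖ ≤ 1 :=
    mem_closedBall_zero_iff.1 i.2
  obtain ⟨f, hf, hlim⟩ := exists_tendstoLocallyUniformly 𝒰 hball
  refine ⟨T f, ⟨f, mem_closedBall_zero_iff.2 hf, rfl⟩, ?_⟩
  have hT := h 𝒰 (fun i => i - f) (fun i => ?_) ?_
  · simp only [map_sub, tendsto_sub_nhds_zero_iff] at hT
    exact hT
  · exact (norm_sub_le _ _).trans (by linarith [hball i])
  · rw [Metric.tendstoLocallyUniformly_iff] at hlim ⊢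
    simpa [dist_eq_norm, HInf.coe_sub, norm_sub_rev] using hlim

/-! ### The Bloch space -/

namespace Bloch

theorem norm_apply_zero_le (g : Bloch) : ‖g.toFun 0‖ ≤ ‖g‖ :=
  le_add_of_nonneg_right ENNReal.toReal_nonneg

theorem blochSemi_le (g : Bloch) : blochSemi g.toFun ≤ ENNReal.ofReal ‖g‖ := by
  rw [← ENNReal.ofReal_toReal g.semi_lt_top.ne]
  exact ENNReal.ofReal_le_ofReal (le_add_of_nonneg_left (norm_nonneg _))

theorem norm_invDeriv_le (g : Bloch) (z : 𝔻) : ‖invDeriv g.toFun z‖ ≤ ‖g‖ :=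
  (ENNReal.ofReal_le_ofReal_iff (norm_nonneg g)).1
    ((ofReal_norm_invDeriv_le g.toFun z).trans g.blochSemi_le)

variable {ι : Type*} {l : Filter ι} {G : ι → Bloch}

theorem tendsto_zero_iff : Tendsto G l (𝓝 0) ↔ Tendsto (fun i => (G i).toFun 0) l (𝓝 0) ∧
    Tendsto (fun i => blochSemi (G i).toFun) l (𝓝 0) := by
  rw [tendsto_zero_iff_norm_tendsto_zero]
  refine ⟨fun h => ⟨squeeze_zero_norm (fun i => (G i).norm_apply_zero_le) h,
    tendsto_of_tendsto_of_tendsto_of_le_of_le tendsto_const_nhds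
      (by simpa only [ENNReal.ofReal_zero] using ENNReal.tendsto_ofReal h)
      (fun _ => zero_le) fun i => (G i).blochSemi_le⟩, fun ⟨h0, hsemi⟩ => ?_⟩
  have hadd := h0.norm.add ((ENNReal.tendsto_toReal ENNReal.zero_ne_top).comp hsemi)
  rwa [norm_zero, ENNReal.toReal_zero, add_zero] at hadd

end Bloch

theorem tendsto_iSup_ofReal_norm {ι α E : Type*} [SeminormedAddCommGroup E] {l : Filter ι}
    {G : ι → α → E} (h : TendstoUniformly G 0 l) :
    Tendsto (fun i => ⨆ x, ENNReal.ofReal ‖G i x‖) l (𝓝 0) := by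
  refine ENNReal.tendsto_nhds_zero.2 fun ε hε => ?_
  rcases eq_or_ne ε ∞ with rfl | hε'
  · exact .of_forall fun _ => le_top
  filter_upwards [Metric.tendstoUniformly_iff.1 h _ (ENNReal.toReal_pos hε.ne' hε')] with i hi
  refine iSup_le fun x => ENNReal.ofReal_le_of_le_toReal ?_
  simpa only [Pi.zero_apply, dist_zero_left] using (hi x).le

theorem tendsto_blochSemi_zero {ι : Type*} {l : Filter ι} {g : ι → 𝔻 → ℂ}
    (h : TendstoUniformly (fun i => invDeriv (g i)) 0 l) :
    Tendsto (fun i => blochSemi (g i)) l (𝓝 0) := by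
  simpa only [blochSemi, norm_invDeriv] using tendsto_iSup_ofReal_norm h

/-! ### The compactness criterion -/

section Compactness

variable {u v : 𝔻 → ℂ} {φ ψ : 𝔻 → 𝔻} {T : HInf →L[ℂ] Bloch} {ι : Type*} {l : Filter ι}
  {F : ι → HInf} {R : ℝ}

theorem Restricts.toFun_apply {S : (𝔻 → ℂ) →ₗ[ℂ] (𝔻 → ℂ)} (hT : Restricts S T) (f : HInf) :
    (T f).toFun = S f := hT f

theorem Restricts.norm_invDeriv_le {S : (𝔻 → ℂ) →ₗ[ℂ] (𝔻 → ℂ)} (hT : Restricts S T) (f : HInf)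
    (hf : ‖f‖ ≤ 1) (z : 𝔻) : ‖invDeriv (S f) z‖ ≤ ‖T‖ := by
  rw [← hT.toFun_apply]
  exact ((T f).norm_invDeriv_le z).trans (T.unit_le_opNorm f hf)

theorem Restricts.tendsto_toFun_zero (hT : Restricts (wComp u φ - wComp v ψ) T)
    (hF : ∀ z, Tendsto (fun i => F i z) l (𝓝 0)) :
    Tendsto (fun i => (T (F i)).toFun 0) l (𝓝 0) := by
  simp only [hT.toFun_apply]
  have h := ((hF (φ 0)).const_mul (u 0)).sub ((hF (ψ 0)).const_mul (v 0))
  rwa [mul_zero, mul_zero, sub_zero] at h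

theorem VanishingJets.isCompactOperator (h : VanishingJets u v φ ψ) (hu : HoloSymbols u φ)
    (hv : HoloSymbols v ψ) (hT : Restricts (wComp u φ - wComp v ψ) T) : IsCompactOperator T :=
  isCompactOperator_of_tendsto_zero fun 𝒰 F hFR hF => by
    refine Bloch.tendsto_zero_iff.2 ⟨hT.tendsto_toFun_zero fun z => ?_, ?_⟩
    · exact tendstoLocallyUniformlyOn_univ.2 hF |>.tendsto_at (Set.mem_univ z)
    · simp only [hT.toFun_apply]
      exact tendsto_blochSemi_zero (h.tendstoUniformly hu hv hFR hF)

theorem tendsto_invDeriv_wComp_apply [l.NeBot] (hu : HoloSymbols u φ) (hFR : ∀ i, ‖F i‖ ≤ R)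
    (hF : ∀ z, Tendsto (fun i => F i z) l (𝓝 0)) (z : 𝔻) :
    Tendsto (fun i => invDeriv (wComp u φ (F i)) z) l (𝓝 0) := by
  have hsup : Tendsto (fun i => localSup (F i) (φ z)) l (𝓝 0) :=
    tendsto_localSup (tendstoLocallyUniformly_of_tendsto_apply hFR hF) (defect_pos (φ z))
      (.of_forall fun _ => le_rfl)
  have hderiv : Tendsto (fun i => invDeriv (F i) (φ z)) l (𝓝 0) :=
    squeeze_zero_norm (fun i => norm_invDeriv_le (F i) (φ z))
      (by simpa only [mul_zero] using hsup.const_mul 4)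
  simpa only [mul_zero, add_zero, ← invDeriv_wComp hu (HInf.holo (F _))] using
    ((hF (φ z)).const_mul (invDeriv u z)).add (hderiv.const_mul (compCoeff u φ z))

theorem Bloch.tendsto_toFun_zero {G : ι → Bloch} {g : Bloch} (h : Tendsto G l (𝓝 g)) :
    Tendsto (fun i => (G i).toFun 0) l (𝓝 (g.toFun 0)) := by
  rw [tendsto_iff_norm_sub_tendsto_zero] at h ⊢
  exact squeeze_zero (fun _ => norm_nonneg _) (fun i => (G i - g).norm_apply_zero_le) h

theorem Bloch.tendsto_invDeriv {G : ι → Bloch} {g : Bloch} (h : Tendsto G l (𝓝 g)) (z : 𝔻) :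
    Tendsto (fun i => invDeriv (G i).toFun z) l (𝓝 (invDeriv g.toFun z)) := by
  rw [tendsto_iff_norm_sub_tendsto_zero] at h ⊢
  refine squeeze_zero (fun _ => norm_nonneg _) (fun i => ?_) h
  rw [← invDeriv_sub (G i).holo g.holo]
  exact (G i - g).norm_invDeriv_le z

theorem Bloch.eq_zero_of_invDeriv {g : Bloch} (h0 : g.toFun 0 = 0)
    (h : ∀ z, invDeriv g.toFun z = 0) : g = 0 := by
  refine g.eq_zero_of_norm ?_
  simp only [norm_def, h0, blochSemi, ← norm_invDeriv, h, norm_zero, ENNReal.ofReal_zero,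
    ENNReal.iSup_zero, ENNReal.toReal_zero, add_zero]

theorem tendsto_zero_of_isCompactOperator (hu : HoloSymbols u φ) (hv : HoloSymbols v ψ)
    (hT : Restricts (wComp u φ - wComp v ψ) T) (hc : IsCompactOperator T)
    (hFR : ∀ i, ‖F i‖ ≤ R) (hF : ∀ z, Tendsto (fun i => F i z) l (𝓝 0)) :
    Tendsto (fun i => T (F i)) l (𝓝 0) := by
  obtain ⟨K, hK, hKT⟩ := IsCompactOperator.image_closedBall_subset_compact
    (f := (T : HInf →ₗ[ℂ] Bloch)) hc R
  refine (tendsto_iff_ultrafilter _ _ _).2 fun 𝒰 h𝒰 => ?_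
  replace hF (z : 𝔻) := (hF z).mono_left h𝒰
  obtain ⟨g, -, hg⟩ : ∃ g ∈ K, Tendsto (fun i => T (F i)) 𝒰 (𝓝 g) :=
    hK.ultrafilter_le_nhds (𝒰.map fun i => T (F i)) <| le_principal_iff.2 <| Filter.mem_map.2 <|
      Eventually.of_forall fun i => hKT ⟨F i, mem_closedBall_zero_iff.2 (hFR i), rfl⟩
  suffices g = 0 by rwa [this] at hg
  refine Bloch.eq_zero_of_invDeriv ?_ fun z => ?_
  · exact tendsto_nhds_unique (Bloch.tendsto_toFun_zero hg) (hT.tendsto_toFun_zero hF)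
  · refine tendsto_nhds_unique (Bloch.tendsto_invDeriv hg z) ?_
    simpa only [hT.toFun_apply, LinearMap.sub_apply, sub_zero,
      invDeriv_sub (hu.holo_wComp (HInf.holo (F _))) (hv.holo_wComp (HInf.holo (F _)))] using
      (tendsto_invDeriv_wComp_apply hu hFR hF z).sub (tendsto_invDeriv_wComp_apply hv hFR hF z)

end Compactness

/-! ### From powers to test functions -/

section Powers

open HInf

variable {E : Type*} [NormedAddCommGroup E] [NormedSpace ℂ E] {T : HInf →L[ℂ] E} {τ : ℝ} {N : ℕ}
  {g : HInf}

theorem tendsto_coord_pow_apply (z : 𝔻) : Tendsto (fun k => (coord ^ k) z) atTop (𝓝 0) :=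
  tendsto_pow_atTop_nhds_zero_of_norm_lt_one z.norm_lt_one

theorem forall_le_of_le_mul_succ_add {x : ℕ → ℝ} {r c : ℝ} (hr0 : 0 ≤ r) (hr1 : r < 1)
    (hx : BddAbove (Set.range x)) (h : ∀ k, x k ≤ r * x (k + 1) + (1 - r) * c) (k : ℕ) :
    x k ≤ c := by
  have hsup : ⨆ k, x k ≤ r * (⨆ k, x k) + (1 - r) * c :=
    ciSup_le fun k => (h k).trans (by gcongr; exact le_ciSup hx (k + 1))
  refine (le_ciSup hx k).trans (le_of_mul_le_mul_left ?_ (sub_pos.2 hr1))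
  linarith

/-- The function `σ_a - a`. -/
def moebiusSub (a : 𝔻) : HInf := moebius a - (a : ℂ) • 1

theorem test_eq (n m : ℕ) (a b : 𝔻) :
    test n m a b = moebiusSub a * (moebius a ^ n * moebius b ^ m) := by
  refine DFunLike.ext _ _ fun z => ?_
  simp only [test, moebiusSub, coe_mul, coe_sub, coe_pow, coe_smul, coe_one, Pi.mul_apply,
    Pi.sub_apply, Pi.pow_apply, Pi.smul_apply, Pi.one_apply, smul_eq_mul]
  ring

theorem coord_pow_mul_moebius_mul (a : 𝔻) (g : HInf) (k : ℕ) :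
    coord ^ k * (moebius a * g) =
      coord ^ k * (moebiusSub a * g) + (a : ℂ) • (coord ^ k * g) := by
  refine DFunLike.ext _ _ fun z => ?_
  simp only [moebiusSub, coe_add, coe_mul, coe_sub, coe_smul, coe_one, Pi.add_apply, Pi.mul_apply,
    Pi.sub_apply, Pi.smul_apply, Pi.one_apply, smul_eq_mul]
  ring

theorem coord_pow_mul_moebiusSub_mul (a : 𝔻) (g : HInf) (k : ℕ) :
    coord ^ k * (moebiusSub a * g) = conj (a : ℂ) • (coord ^ (k + 1) * (moebiusSub a * g)) -
      (defect a : ℂ) • (coord ^ (k + 1) * g) := by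
  refine DFunLike.ext _ _ fun z => ?_
  have h : (1 - conj (a : ℂ) * z) * moebiusSub a z = -(defect a * z) := by
    simpa only [moebiusSub, coe_sub, coe_smul, coe_one, coe_moebius, Pi.sub_apply, Pi.smul_apply,
      Pi.one_apply, smul_eq_mul, mul_one] using one_sub_conj_mul_σ_sub a z
  have hz : coord z = z := rfl
  simp only [coe_mul, coe_sub, coe_pow, coe_smul, Pi.mul_apply, Pi.sub_apply, Pi.smul_apply,
    Pi.pow_apply, smul_eq_mul, hz]
  linear_combination (z : ℂ) ^ k * g z * h

theorem norm_map_coord_pow_mul_moebiusSub_le (a : 𝔻) (g : HInf) (k : ℕ) :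
    ‖T (coord ^ k * (moebiusSub a * g))‖ ≤
      ‖(a : ℂ)‖ * ‖T (coord ^ (k + 1) * (moebiusSub a * g))‖ +
        defect a * ‖T (coord ^ (k + 1) * g)‖ := by
  rw [coord_pow_mul_moebiusSub_mul, map_sub, map_smul, map_smul]
  refine (norm_sub_le _ _).trans_eq ?_
  rw [norm_smul, norm_smul, Complex.norm_conj, Complex.norm_of_nonneg (defect_pos a).le]

theorem norm_map_coord_pow_mul_le (g : HInf) (k : ℕ) : ‖T (coord ^ k * g)‖ ≤ ‖T‖ * ‖g‖ := by
  refine T.le_opNorm_of_le ((norm_mul_le _ _).trans ?_)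
  exact mul_le_of_le_one_left (norm_nonneg g) (norm_pow_le_one norm_coord_le k)

theorem norm_map_moebiusSub_mul_le_two_mul (a : 𝔻) (hN : ∀ k ≥ N, ‖T (coord ^ k * g)‖ ≤ τ) :
    ∀ k ≥ N, ‖T (coord ^ k * (moebiusSub a * g))‖ ≤ 2 * τ := by
  have hbdd : BddAbove (Set.range fun k => ‖T (coord ^ (N + k) * (moebiusSub a * g))‖) :=
    ⟨_, Set.forall_mem_range.2 fun k => norm_map_coord_pow_mul_le _ _⟩
  have hrec := forall_le_of_le_mul_succ_add (c := 2 * τ) (norm_nonneg (a : ℂ)) a.norm_lt_one hbdd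
    fun k => (norm_map_coord_pow_mul_moebiusSub_le a g (N + k)).trans <| by
      have hdefect : defect a ≤ (1 - ‖(a : ℂ)‖) * 2 := by
        unfold defect
        nlinarith [sq_nonneg (1 - ‖(a : ℂ)‖)]
      rw [← mul_assoc (1 - _), add_assoc N]
      exact add_le_add_right (mul_le_mul hdefect (hN _ (by lia)) (norm_nonneg _)
        (by linarith [a.norm_lt_one])) _
  intro k hk
  obtain ⟨j, rfl⟩ := Nat.exists_eq_add_of_le hk
  exact hrec j

theorem norm_map_moebius_mul_le (a : 𝔻) (hN : ∀ k ≥ N, ‖T (coord ^ k * g)‖ ≤ τ) :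
    ∀ k ≥ N, ‖T (coord ^ k * (moebius a * g))‖ ≤ 3 * τ := by
  intro k hk
  have hsub := norm_map_moebiusSub_mul_le_two_mul a hN k hk
  have hsmul : ‖(a : ℂ)‖ * ‖T (coord ^ k * g)‖ ≤ τ :=
    (mul_le_of_le_one_left (norm_nonneg _) a.norm_lt_one.le).trans (hN k hk)
  rw [coord_pow_mul_moebius_mul, map_add, map_smul]
  refine (norm_add_le _ _).trans ?_
  rw [norm_smul]
  linarith

theorem norm_map_moebius_pow_mul_le (a : 𝔻) (hN : ∀ k ≥ N, ‖T (coord ^ k * g)‖ ≤ τ) (n : ℕ) :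
    ∀ k ≥ N, ‖T (coord ^ k * (moebius a ^ n * g))‖ ≤ 3 ^ n * τ := by
  induction n with
  | zero => simpa only [pow_zero, one_mul] using hN
  | succ n ih =>
    rw [pow_succ', pow_succ', mul_assoc, mul_assoc]
    exact norm_map_moebius_mul_le a ih

theorem norm_map_moebiusSub_mul_le (a : 𝔻) (g : HInf) (k : ℕ) :
    ‖T (moebiusSub a * g)‖ ≤
      ‖T (coord ^ k * (moebiusSub a * g))‖ + k * (defect a * (‖T‖ * ‖g‖)) := by
  induction k with
  | zero => rw [pow_zero, one_mul, Nat.cast_zero, zero_mul, add_zero]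
  | succ k ih =>
    have hstep := norm_map_coord_pow_mul_moebiusSub_le (T := T) a g k
    have hcontract : ‖(a : ℂ)‖ * ‖T (coord ^ (k + 1) * (moebiusSub a * g))‖ ≤
        ‖T (coord ^ (k + 1) * (moebiusSub a * g))‖ :=
      mul_le_of_le_one_left (norm_nonneg _) a.norm_lt_one.le
    have hdefect := mul_le_mul_of_nonneg_left (norm_map_coord_pow_mul_le (T := T) g (k + 1))
      (defect_pos a).le
    push_cast
    linarith

theorem norm_map_test_le (hN : ∀ k ≥ N, ‖T (coord ^ k)‖ ≤ τ) (n m : ℕ) (a b : 𝔻) :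
    ‖T (test n m a b)‖ ≤ 2 * (3 ^ n * (3 ^ m * τ)) + N * (defect a * ‖T‖) := by
  have hb := norm_map_moebius_pow_mul_le b (g := 1) (by simpa only [mul_one] using hN) m
  have ha := norm_map_moebiusSub_mul_le_two_mul a (norm_map_moebius_pow_mul_le a hb n) N le_rfl
  have hg : ‖moebius a ^ n * (moebius b ^ m * 1)‖ ≤ 1 := by
    rw [mul_one]
    exact norm_mul_le_one (norm_pow_le_one (norm_moebius_le a) n)
      (norm_pow_le_one (norm_moebius_le b) m)
  rw [test_eq, ← mul_one (moebius b ^ m)]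
  refine (norm_map_moebiusSub_mul_le a _ N).trans (add_le_add ha ?_)
  have := defect_pos a
  gcongr
  exact mul_le_of_le_one_right (norm_nonneg T) hg

theorem tendstoUniformly_map_test (hT : Tendsto (fun k => T (coord ^ k)) atTop (𝓝 0)) (n m : ℕ) :
    TendstoUniformly (fun a b => T (test n m a b)) 0 toBoundary := by
  refine Metric.tendstoUniformly_iff.2 fun ε hε => ?_
  obtain ⟨τ, hτ, hτε⟩ : ∃ τ > 0, 2 * (3 ^ n * (3 ^ m * τ)) < ε / 2 :=
    ⟨ε / (8 * 3 ^ n * 3 ^ m), by positivity, by field_simp; norm_num⟩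
  obtain ⟨N, hN⟩ := eventually_atTop.1 (Metric.tendsto_nhds.1 hT τ hτ)
  replace hN (k : ℕ) (hk : N ≤ k) : ‖T (coord ^ k)‖ ≤ τ := by
    simpa only [dist_zero_right] using (hN k hk).le
  have hdefect : Tendsto (fun a => N * (defect a * ‖T‖)) toBoundary (𝓝 0) := by
    have h := ((tendsto_toBoundary_iff.1 tendsto_id).mul_const ‖T‖).const_mul (N : ℝ)
    rwa [zero_mul, mul_zero] at h
  filter_upwards [hdefect.eventually_lt_const (half_pos hε)] with a ha b
  rw [Pi.zero_apply, dist_zero_left]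
  linarith [norm_map_test_le hN n m a b]

end Powers

section Equivalence

variable {u v : 𝔻 → ℂ} {φ ψ : 𝔻 → 𝔻} {T : HInf →L[ℂ] Bloch}

theorem Restricts.toFun_coord_pow (hT : Restricts (wComp u φ - wComp v ψ) T) (k : ℕ) :
    (T (HInf.coord ^ k)).toFun = fun z => u z * φ z ^ k - v z * ψ z ^ k :=
  hT.toFun_apply _

theorem Restricts.tendsto_coord_pow_iff (hT : Restricts (wComp u φ - wComp v ψ) T) :
    Tendsto (fun k => T (HInf.coord ^ k)) atTop (𝓝 0) ↔
      Tendsto (fun k => blochSemi (fun z => u z * φ z ^ k - v z * ψ z ^ k)) atTop (𝓝 0) := by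
  rw [Bloch.tendsto_zero_iff, and_iff_right (hT.tendsto_toFun_zero tendsto_coord_pow_apply)]
  simp only [hT.toFun_coord_pow]

theorem Restricts.testVanish (hT : Restricts (wComp u φ - wComp v ψ) T)
    (h : Tendsto (fun k => T (HInf.coord ^ k)) atTop (𝓝 0)) (n m : ℕ) : TestVanish u v φ ψ n m :=
  tendsto_of_tendsto_of_tendsto_of_le_of_le tendsto_const_nhds
    (tendsto_iSup_ofReal_norm (tendstoUniformly_map_test h n m)) (fun _ => zero_le)
    fun a => iSup_mono fun b => by
      rw [← HInf.coe_test, ← hT.toFun_apply]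
      exact (T (HInf.test n m a b)).blochSemi_le

end Equivalence

end BlochDiff

end

theorem theorem3p2 (u v : 𝔻 → ℂ) (φ ψ : 𝔻 → 𝔻)
    (hu : Holo u) (hv : Holo v)
    (hφ : Holo (fun z => (φ z : ℂ))) (hψ : Holo (fun z => (ψ z : ℂ)))
    (hA : CondA u v φ ψ) (hB : CondB u v φ ψ)
    (hbdd : IsBoundedOp (wComp u φ - wComp v ψ)) :
    List.TFAE [
      IsCompactOp (wComp u φ - wComp v ψ),
      ∀ p ∈ ({(0, 0), (0, 1), (0, 2), (1, 2)} : Set (ℕ × ℕ)),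
        Tendsto
          (fun a : 𝔻 => ⨆ b : 𝔻, blochSemi ((wComp u φ - wComp v ψ) (testFun p.1 p.2 a b)))
          toBoundary (𝓝 0),
      Tendsto
        (fun k : ℕ => blochSemi (fun z => u z * (φ z : ℂ) ^ k - v z * (ψ z : ℂ) ^ k))
        atTop (𝓝 0)] := by
  have hu' : HoloSymbols u φ := ⟨hu, hφ⟩
  have hv' : HoloSymbols v ψ := ⟨hv, hψ⟩
  obtain ⟨T, hT⟩ := hbdd
  tfae_have 1 → 3 := fun ⟨_, hT, hc⟩ => hT.tendsto_coord_pow_iff.1 <|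
    tendsto_zero_of_isCompactOperator hu' hv' hT hc (HInf.norm_pow_le_one HInf.norm_coord_le)
      tendsto_coord_pow_apply
  tfae_have 3 → 2 := fun h p _ => hT.testVanish (hT.tendsto_coord_pow_iff.2 h) p.1 p.2
  tfae_have 2 → 1 := fun h => by
    have hjets : VanishingJets u v φ ψ :=
      vanishingJets_of_testVanish hu' hv' hA hB hT.norm_invDeriv_le
        (h (0, 0) (by simp)) (h (0, 1) (by simp)) (h (0, 2) (by simp)) (h (1, 2) (by simp))
    exact ⟨T, hT, hjets.isCompactOperator hu' hv' hT⟩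
  tfae_finish
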